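/- Let $N=(0,0,1)$, $S=(0,0,-1)$, $U_I=S^2\setminus\{N,S\}$ with spherical coordinates $(\theta,\phi)$, and for $R\in SO(3)$ let $U_R=RU_I$ with the rotated coordinates $(\theta_R,\phi_R)=(\theta,\phi)\circ R^{-1}$. For $x\in U_R$ let $\rho_R(x)$ be the unit tangent vector at $x$ pointing in the direction of increasing $\phi_R$ (with $\theta_R$ constant). Orient $S^2$ so that $(\partial/\partial x,\partial/\partial y)$ is an oriented basis at $S$, and for $x\in U_{R_1}\cap U_{R_2}$ let $\psi_{xR_2R_1}\in(-\pi,\pi]$ be the angle from $\rho_{R_1}(x)$ to $\rho_{R_2}(x)$. For $s\in\mathbb Z$, a spin $s$ function on $S^2$ is a family $f=(f_R)_{R\in SO(3)}$ of functions $f_R:U_R\to\mathbb C$ with $f_{R_2}(x)=e^{is\psi_{xR_2R_1}}f_{R_1}(x)$ for all $R_1,R_2$ and all $x\in U_{R_1}\cap U_{R_2}$. Let $L^2_s$ be the Hilbert space of (classes of) spin $s$ functions with all $f_R\in L^2(U_R,dS)$, where $dS$ is surface measure, with the inner product $\langle f,g\rangle=\int_{S^2} f_R\overline{g_R}\,dS$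 (independent of $R$). On smooth spin $s$ functions let $(\partial f)_R=-(\sin\theta_R)^s\left(\frac{\partial}{\partial\theta_R}+\frac{i}{\sin\theta_R}\frac{\partial}{\partial\phi_R}\right)\left[(\sin\theta_R)^{-s}f_R\right]$, a spin $s+1$ function, and $\overline\partial f=\overline{\partial\overline f}$, a spin $s-1$ function. For integers $l\ge 0$ and $-l\le m\le l$ let $Y_{lm}$ be the standard orthonormal spherical harmonic $$Y_{lm}(\theta,\phi)=e^{im\phi}(-1)^{\max(-m,0)}\frac{1}{l!}\left[\frac{(l+m)!(l-m)!(2l+1)}{4\pi}\right]^{1/2}\sin^{2l}(\theta/2)\sum_r\binom{l}{r}\binom{l}{r-m}(-1)^{l-r}\cot^{2r-m}(\theta/2),$$ extended continuously to $S^2$ and regarded as a spin $0$ function. For $l\ge|s|$ put $${}_sY_{lm}=\left[\frac{(l-s)!}{(l+s)!}\right]^{1/2}\partial^sY_{lm}\ \ (s\ge0),\qquad {}_sY_{lm}=\left[\frac{(l+s)!}{(l-s)!}\right]^{1/2}(-\overline\partial)^{-s}Y_{lm}\ \ (s<0),$$ let $\mathcal H_{ls}$ be the linear span of the ${}_sY_{lm}$,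 $-l\le m\le l$, and for $x\in U_{R'}$, $y\in U_R$ put $$K^{ls}_{R',R}(x,y)=\sum_{m=-l}^{l}{}_sY_{lm,R'}(x)\,\overline{{}_sY_{lm,R}(y)}.$$ **Theorem.** Let $s\in\mathbb Z$ and let $l\ge|s|$ be an integer. Then $\mathcal H_{ls}\subset L^2_s$ and $K^{ls}$ is the smooth kernel of the orthogonal projection $P_{ls}$ of $L^2_s$ onto $\mathcal H_{ls}$: every $K^{ls}_{R',R}$ is smooth on $U_{R'}\times U_R$, and $(P_{ls}f)_{R'}(x)=\int_{S^2}K^{ls}_{R',R}(x,y)f_R(y)\,dS(y)$ for all $f\in L^2_s$, all $R,R'\in SO(3)$ and all $x\in U_{R'}$. The diagonal of this kernel is constant: for every $R\in SO(3)$ and every $x\in U_R$, $$K^{ls}_{R,R}(x,x)=\frac{2l+1}{4\pi}.$$ -/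

import Mathlib

open scoped Manifold ContDiff

noncomputable section

namespace SpinSphere

/-- Euclidean three-space. -/
abbrev E3 : Type := EuclideanSpace ℝ (Fin 3)

/-- The unit sphere `S²` in Euclidean three-space. -/
abbrev S2 : Type := Metric.sphere (0 : E3) 1

/-- The rotation group `SO(3)`. -/
abbrev SO3 : Type := Matrix.specialOrthogonalGroup (Fin 3) ℝ

/-- The usual surface measure `dS` on `S²` (of total mass `4π`). -/
def dS : MeasureTheory.Measure S2 :=
  (MeasureTheory.volume : MeasureTheory.Measure E3).toSphere

/-! ### Rotations, charts and spherical coordinates -/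

/-- The action of a rotation on vectors. -/
def rotVec (R : SO3) (v : E3) : E3 := WithLp.toLp 2 (R.1.mulVec v.ofLp)

lemma norm_rotVec (R : SO3) (v : E3) : ‖rotVec R v‖ = ‖v‖ := by
  have h : R.1.transpose * R.1 = 1 := by
    have := (Matrix.mem_specialOrthogonalGroup_iff.1 R.2).1
    simpa [Matrix.star_eq_conjTranspose] using (Matrix.mem_orthogonalGroup_iff' _ _).1 this
  have key : R.1.mulVec v.ofLp ⬝ᵥ R.1.mulVec v.ofLp = v.ofLp ⬝ᵥ v.ofLp := by
    rw [Matrix.dotProduct_mulVec, Matrix.vecMul_mulVec, h, Matrix.vecMul_one]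
  simp only [EuclideanSpace.norm_eq, rotVec, Real.norm_eq_abs, sq_abs]
  congr 1
  simpa [dotProduct, sq] using key

/-- The action of a rotation on the sphere. -/
def rot (R : SO3) (x : S2) : S2 :=
  ⟨rotVec R x.1, by
    have hx := x.2
    rw [mem_sphere_zero_iff_norm] at hx ⊢
    rw [norm_rotVec, hx]⟩

/-- The north pole `N = (0,0,1)`. -/
def northPole : S2 :=
  ⟨!₂[0, 0, 1], by simp [EuclideanSpace.norm_eq, Fin.sum_univ_three]⟩

/-- The south pole `S = (0,0,-1)`. -/
def southPole : S2 :=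
  ⟨!₂[0, 0, -1], by simp [EuclideanSpace.norm_eq, Fin.sum_univ_three]⟩

/-- The chart domain `U_I = S² ∖ {N, S}`, rotated: `U_R = R U_I`. -/
def U (R : SO3) : Set S2 := rot R '' {northPole, southPole}ᶜ

/-- The point of `S²` with colatitude `θ` and longitude `φ`. -/
def sphPoint (θ φ : ℝ) : S2 :=
  ⟨!₂[Real.sin θ * Real.cos φ, Real.sin θ * Real.sin φ, Real.cos θ], by
    rw [mem_sphere_zero_iff_norm, EuclideanSpace.norm_eq, Real.sqrt_eq_one]
    simp only [Fin.sum_univ_three, Real.norm_eq_abs, sq_abs, Matrix.cons_val]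
    linear_combination (Real.sin θ) ^ 2 * Real.sin_sq_add_cos_sq φ + Real.sin_sq_add_cos_sq θ⟩

/-- The colatitude `θ` of a point. -/
def colat (x : S2) : ℝ := Real.arccos (x.1 2)

/-- The longitude `φ` of a point (junk value `0` at the two poles). -/
def lon (x : S2) : ℝ := Complex.arg (⟨x.1 0, x.1 1⟩ : ℂ)

/-- The coordinate `θ_R = θ ∘ R⁻¹` on `U_R`. -/
def colatR (R : SO3) (x : S2) : ℝ := colat (rot R⁻¹ x)

/-- The coordinate `φ_R = φ ∘ R⁻¹` on `U_R`. -/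
def lonR (R : SO3) (x : S2) : ℝ := lon (rot R⁻¹ x)

/-! ### Reference directions and angles -/

/-- `ρ_I(x)`: the unit tangent vector at `x ∈ U_I`, tangent to the circle `θ = const` and pointing
in the direction of increasing `φ`. -/
def rhoI (x : S2) : E3 := !₂[-Real.sin (lon x), Real.cos (lon x), 0]

/-- `ρ_R(Rx) = R_* ρ_I(x)`. -/
def rho (R : SO3) (x : S2) : E3 := rotVec R (rhoI (rot R⁻¹ x))

/-- The rotation by a right angle in the tangent plane at `x`, `J v = v × x`.  It is the positive
one for the orientation of `S²` in which `(∂/∂x, ∂/∂y)` is an oriented basis at the south pole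
(and `(∂/∂y, ∂/∂x)` is one at the north pole). -/
def J (x : S2) (v : E3) : E3 := WithLp.toLp 2 (crossProduct v.ofLp x.1.ofLp)

/-- The angle in `(-π, π]` from the tangent vector `v` to the tangent vector `w` at `x`. -/
def angle (x : S2) (v w : E3) : ℝ := Complex.arg (⟨inner ℝ v w, inner ℝ (J x v) w⟩ : ℂ)

/-- `ψ_{x R₂ R₁}`, the angle from `ρ_{R₁}(x)` to `ρ_{R₂}(x)`. -/
def psi (x : S2) (R₂ R₁ : SO3) : ℝ := angle x (rho R₁ x) (rho R₂ x)

/-! ### Spin functions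

A spin `s` function on `S²` is a family `f = (f_R)`, `R ∈ SO(3)`, of functions `f_R` on `U_R` with
`f_{R₂} = e^{isψ} f_{R₁}` on `U_{R₁} ∩ U_{R₂}`.  The families below consist of total functions; only
the values of `f_R` on `U_R` are ever relevant. -/

/-- Families `(f_R)` of complex functions indexed by `R ∈ SO(3)`. -/
abbrev Family : Type := SO3 → S2 → ℂ

/-- The transition law of spin `s`. -/
def HasSpin (s : ℤ) (f : Family) : Prop :=
  ∀ (R₁ R₂ : SO3) (x : S2), x ∈ U R₁ → x ∈ U R₂ →
    f R₂ x = Complex.exp (Complex.I * s * psi x R₂ R₁) * f R₁ x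

/-- `f` is a representative of an element of `L²_s(S²)`, the square integrable spin `s` functions
(sections of the line bundle `L^s`). -/
def IsL2Spin (s : ℤ) (f : Family) : Prop :=
  HasSpin s f ∧ ∀ R : SO3, MeasureTheory.MemLp (f R) 2 (dS.restrict (U R))

/-- The inner product `⟨f, g⟩ = ∫ f_R conj(g_R) dS` of `L²_s(S²)`, which does not depend on `R` and
is written with `R = I`. -/
def spinInner (f g : Family) : ℂ :=
  ∫ x in U 1, f 1 x * (starRingEnd ℂ) (g 1 x) ∂dS

/-- The spin raising operator on spin `s` functions: `(∂f)_R = ∂_{sR} f_R` with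
`∂_{sR} h = -(sin θ_R)^s (∂/∂θ_R + (i / sin θ_R) ∂/∂φ_R) ((sin θ_R)^{-s} h)`. -/
def edth (s : ℤ) (f : Family) : Family := fun R x =>
  -((Real.sin (colatR R x) : ℂ) ^ s) *
    (deriv (fun t : ℝ => (Real.sin t : ℂ) ^ (-s) * f R (rot R (sphPoint t (lonR R x))))
        (colatR R x)
      + Complex.I / (Real.sin (colatR R x) : ℂ) *
        deriv (fun u : ℝ => (Real.sin (colatR R x) : ℂ) ^ (-s) *
          f R (rot R (sphPoint (colatR R x) u))) (lonR R x))

/-- Complex conjugation, from spin `s` functions to spin `-s` functions. -/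
def conjF (f : Family) : Family := fun R x => (starRingEnd ℂ) (f R x)

/-- The spin lowering operator on spin `s` functions, `∂̄ f = conj (∂ (conj f))`. -/
def edthBar (s : ℤ) (f : Family) : Family := conjF (edth (-s) (conjF f))

/-- `∂ⁿ` applied to a spin `0` function. -/
def raise : ℕ → Family → Family
  | 0, f => f
  | n + 1, f => edth n (raise n f)

/-- `(-∂̄)ⁿ` applied to a spin `0` function. -/
def lower : ℕ → Family → Family
  | 0, f => f
  | n + 1, f => -edthBar (-n) (lower n f)

/-! ### Spherical harmonics -/

/-- The standard orthonormal spherical harmonic `Y_{lm}` on `S²`, `-l ≤ m ≤ l`, with the phase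
convention `conj Y_{lm} = Y_{l,-m}`:
`e^{imφ} (-1)^{m⁻} (a_{lm} / l!) sin^{2l}(θ/2) ∑_r C(l,r) C(l,r-m) (-1)^{l-r} cot^{2r-m}(θ/2)`, where
`a_{lm} = [(l+m)! (l-m)! (2l+1) / 4π]^{1/2}`.  The sum is written over the pairs `(r, j)` in
`{0,…,l}²` with `r - j = m`, and `sin^{2l} cot^{r+j}` as `cos^{r+j} sin^{2l-r-j}`, which is also
correct at the poles. -/
def Y (l : ℕ) (m : ℤ) (x : S2) : ℂ :=
  Complex.exp (Complex.I * m * lon x) *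
    (((-1 : ℝ) ^ (-m).toNat *
      (Real.sqrt (((l + m).toNat.factorial : ℝ) * ((l - m).toNat.factorial : ℝ) * (2 * l + 1)
        / (4 * Real.pi)) / (l.factorial : ℝ)) *
      ∑ p ∈ (Finset.range (l + 1) ×ˢ Finset.range (l + 1)).filter
          (fun p => (p.1 : ℤ) - (p.2 : ℤ) = m),
        (l.choose p.1 : ℝ) * (l.choose p.2 : ℝ) * (-1 : ℝ) ^ (l - p.1) *
          Real.cos (colat x / 2) ^ (p.1 + p.2) *
          Real.sin (colat x / 2) ^ (2 * l - p.1 - p.2) : ℝ) : ℂ)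

/-- A function on `S²` as a spin `0` function. -/
def toFamily (h : S2 → ℂ) : Family := fun _ x => h x

/-- The spin `s` spherical harmonic `ₛY_{lm}`, for `|s| ≤ l`: with `n = |s|` it is
`[(l-n)!/(l+n)!]^{1/2} ∂ⁿ Y_{lm}` if `s ≥ 0` and `[(l-n)!/(l+n)!]^{1/2} (-∂̄)ⁿ Y_{lm}` if `s < 0`. -/
def spinY (s : ℤ) (l : ℕ) (m : ℤ) : Family :=
  ((Real.sqrt (((l - s.natAbs).factorial : ℝ) / ((l + s.natAbs).factorial : ℝ)) : ℝ) : ℂ) •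
    (if 0 ≤ s then raise s.natAbs (toFamily (Y l m)) else lower s.natAbs (toFamily (Y l m)))

/-- `H_{ls}`, the span of the `ₛY_{lm}`, `-l ≤ m ≤ l`. -/
def spinH (l : ℕ) (s : ℤ) : Submodule ℂ Family :=
  Submodule.span ℂ (spinY s l '' Set.Icc (-(l : ℤ)) l)

/-! ### Kernels -/

/-- `K = (K_{R',R})` is the (smooth) kernel of the orthogonal projection of `L²_s(S²)` onto its
subspace `H`: every `K_{R',R}` is smooth on `U_{R'} × U_R`, and for every `f` in `L²_s(S²)` the
orthogonal projection `g` of `f` onto `H` satisfies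
`g_{R'}(x) = ∫ K_{R',R}(x,y) f_R(y) dS(y)` for all `R, R'` and all `x ∈ U_{R'}`. -/
def IsProjectionKernel (s : ℤ) (H : Submodule ℂ Family) (K : SO3 → SO3 → S2 → S2 → ℂ) : Prop :=
  (∀ h ∈ H, IsL2Spin s h) ∧
  (∀ R' R : SO3, ContMDiffOn ((𝓡 2).prod (𝓡 2)) 𝓘(ℝ, ℂ) ∞
    (fun p : S2 × S2 => K R' R p.1 p.2) (U R' ×ˢ U R)) ∧
  ∀ f : Family, IsL2Spin s f → ∃ g ∈ H, (∀ h ∈ H, spinInner (f - g) h = 0) ∧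
    ∀ R' R : SO3, ∀ x ∈ U R', g R' x = ∫ y in U R, K R' R x y * f R y ∂dS

/-- `K^{ls}_{R',R}(x,y) = ∑_{m=-l}^{l} ₛY_{lmR'}(x) conj(ₛY_{lmR}(y))`. -/
def projKernel (l : ℕ) (s : ℤ) (R' R : SO3) (x y : S2) : ℂ :=
  ∑ m ∈ Finset.Icc (-(l : ℤ)) l, spinY s l m R' x * (starRingEnd ℂ) (spinY s l m R y)

end SpinSphere

end

set_option linter.unusedSimpArgs false

noncomputable section

namespace SpinSphere

/-! ### Rotations and tangent frames -/

/-! Let m = e_θ + i e_φ be the complex tangent vector `frame R x`. Changing `R` multiplies m by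
e^{iψ} (`frame_eq`), so degree s in m, or degree -s in its conjugate, means spin s. For a constant
vector a, the operator ∂_θ + (i/sin θ)∂_φ sends x·a to m·a and m·a to cot θ (m·a). The weight (sin
θ)^{-n} removes the cotangent, so ∂ sends (x·a)^p (m·a)^n to -p (x·a)^{p-1} (m·a)^{n+1}
(`edth_sum_pow`).

Up to a constant, Y_{lm} is the coefficient of z^{l-m} in (x·a(z))^l with a(z) = `isoVec z`
(`Y_eq_coeff`). Coefficients are linear combinations of values, so ₛY_{lm} is a constant times a
coefficient of `spinPoly` (`spinY_eq`). In standard coordinates there are half-angle spinors A, B,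
linear in z, with x·a = AB, m·a = -A² and m̄·a = B²; hence `spinPoly` is a phase times A^{l+s}
B^{l-s}. The coefficient vectors of A and B are orthonormal, so the U(2)-invariant norm
Σ|c_k|²/C(2l,k) of this form is 1/C(2l,l-s) at every point (`sum_coeff_mul_star_coeff`). The squared
constants of ₛY_{lm} are proportional to the weights of that norm (`spinConst_sq`), and the diagonal
value follows.

Orthonormality comes from symmetry. Rotations about the z-axis kill the off-diagonal Gram entries
(`gram_eq_zero`), rotations about the y-axis fix the ratios of the diagonal ones (`gram_diag`), and
integrating the constant diagonal over the area 4π fixes the scale (`harm_normalized`). The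
projection kernel is then the usual sum over an orthonormal basis. -/

lemma SO3.transpose_mul (R : SO3) : R.1.transpose * R.1 = 1 := by
  have := (Matrix.mem_specialOrthogonalGroup_iff.1 R.2).1
  simpa [Matrix.star_eq_conjTranspose] using (Matrix.mem_orthogonalGroup_iff' _ _).1 this

lemma SO3.mul_transpose (R : SO3) : R.1 * R.1.transpose = 1 :=
  mul_eq_one_comm.1 R.transpose_mul

lemma SO3.det_eq_one (R : SO3) : R.1.det = 1 := (Matrix.mem_specialOrthogonalGroup_iff.1 R.2).2

lemma rotVec_apply (R : SO3) (v : E3) (i : Fin 3) :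
    rotVec R v i = R.1 i 0 * v 0 + R.1 i 1 * v 1 + R.1 i 2 * v 2 := by
  simp [rotVec, Matrix.mulVec, dotProduct, Fin.sum_univ_three]

lemma rotVec_one (v : E3) : rotVec 1 v = v := by simp [rotVec]

lemma rotVec_mul (R R' : SO3) (v : E3) : rotVec (R * R') v = rotVec R (rotVec R' v) := by
  simp [rotVec, Matrix.mulVec_mulVec]

lemma rot_coe (R : SO3) (x : S2) : (rot R x).1 = rotVec R x.1 := rfl

@[simp] lemma rot_one (x : S2) : rot 1 x = x := Subtype.ext (rotVec_one _)

lemma rot_mul (R R' : SO3) (x : S2) : rot (R * R') x = rot R (rot R' x) :=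
  Subtype.ext (rotVec_mul _ _ _)

@[simp] lemma rot_inv_rot (R : SO3) (x : S2) : rot R⁻¹ (rot R x) = x := by
  rw [← rot_mul, inv_mul_cancel, rot_one]

@[simp] lemma rot_rot_inv (R : SO3) (x : S2) : rot R (rot R⁻¹ x) = x := by
  rw [← rot_mul, mul_inv_cancel, rot_one]

lemma mem_U_iff (R : SO3) (x : S2) :
    x ∈ U R ↔ rot R⁻¹ x ≠ northPole ∧ rot R⁻¹ x ≠ southPole := by
  constructor
  · rintro ⟨y, hy, rfl⟩
    simpa using hy
  · intro h
    exact ⟨rot R⁻¹ x, by simpa using h, by simp⟩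

lemma sum_sq_eq_one (x : S2) : x.1 0 ^ 2 + x.1 1 ^ 2 + x.1 2 ^ 2 = 1 := by
  have h := x.2
  rw [mem_sphere_zero_iff_norm, EuclideanSpace.norm_eq, Real.sqrt_eq_one] at h
  simpa [Fin.sum_univ_three] using h

/-- `v` is a unit tangent vector at `x`. -/
def IsUnitTangent (x : S2) (v : E3) : Prop :=
  v 0 ^ 2 + v 1 ^ 2 + v 2 ^ 2 = 1 ∧ v 0 * x.1 0 + v 1 * x.1 1 + v 2 * x.1 2 = 0

lemma J_zero (x : S2) (v : E3) : J x v 0 = v 1 * x.1 2 - v 2 * x.1 1 := by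
  simp [J, cross_apply]
lemma J_one (x : S2) (v : E3) : J x v 1 = v 2 * x.1 0 - v 0 * x.1 2 := by
  simp [J, cross_apply]
lemma J_two (x : S2) (v : E3) : J x v 2 = v 0 * x.1 1 - v 1 * x.1 0 := by
  simp [J, cross_apply]

lemma inner_E3 (v w : E3) : inner ℝ v w = v 0 * w 0 + v 1 * w 1 + v 2 * w 2 := by
  simp [PiLp.inner_apply, Fin.sum_univ_three]; ring

/-- A real vector, regarded as a complex one. -/
def cvec (v : E3) : Fin 3 → ℂ := fun i => (v i : ℂ)

/-- The complex tangent vector `Jv + iv`. -/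
def tvec (x : S2) (v : E3) : Fin 3 → ℂ := cvec (J x v) + Complex.I • cvec v

lemma tvec_apply (x : S2) (v : E3) (i : Fin 3) :
    tvec x v i = (J x v i : ℂ) + Complex.I * v i := by simp [tvec, cvec]

/-- A right inverse of a square matrix is also a left inverse: orthonormal rows give OᵀO = 1, which
is the expansion of w. -/
lemma orthonormal_completeness (a b c : Fin 3 → ℝ) (haa : a ⬝ᵥ a = 1) (hbb : b ⬝ᵥ b = 1)
    (hcc : c ⬝ᵥ c = 1) (hab : a ⬝ᵥ b = 0) (hac : a ⬝ᵥ c = 0) (hbc : b ⬝ᵥ c = 0)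
    (w : Fin 3 → ℝ) : w = (a ⬝ᵥ w) • a + (b ⬝ᵥ w) • b + (c ⬝ᵥ w) • c := by
  set O : Matrix (Fin 3) (Fin 3) ℝ := Matrix.of ![a, b, c] with hO
  have h1 : O * O.transpose = 1 := by
    ext i j
    change ![a, b, c] i ⬝ᵥ ![a, b, c] j = _
    fin_cases i <;> fin_cases j <;>
      simp [haa, hbb, hcc, hab, hac, hbc, dotProduct_comm b a,
        dotProduct_comm c a, dotProduct_comm c b]
  have h2 := mul_eq_one_comm.1 h1
  have h3 : w = O.transpose.mulVec (O.mulVec w) := by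
    rw [Matrix.mulVec_mulVec, h2, Matrix.one_mulVec]
  conv_lhs => rw [h3]
  ext i
  simp [hO, Matrix.mulVec, dotProduct, Fin.sum_univ_three]
  ring

lemma IsUnitTangent.decomp {x : S2} {v w : E3} (hv : IsUnitTangent x v)
    (hw : IsUnitTangent x w) (i : Fin 3) :
    w i = inner ℝ v w * v i + inner ℝ (J x v) w * J x v i := by
  have hx := sum_sq_eq_one x
  obtain ⟨hv1, hv2⟩ := hv
  obtain ⟨hw1, hw2⟩ := hw
  have := orthonormal_completeness v.ofLp (J x v).ofLp x.1.ofLp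
    (by simp [dotProduct, Fin.sum_univ_three]; linarith)
    (by
      simp only [dotProduct, Fin.sum_univ_three, J_zero, J_one, J_two]
      linear_combination (v 0 ^ 2 + v 1 ^ 2 + v 2 ^ 2) * hx + hv1 -
        (v 0 * x.1 0 + v 1 * x.1 1 + v 2 * x.1 2) * hv2)
    (by simp [dotProduct, Fin.sum_univ_three]; linarith)
    (by simp only [dotProduct, Fin.sum_univ_three, J_zero, J_one, J_two]; ring)
    (by simp only [dotProduct, Fin.sum_univ_three]; linarith)
    (by simp only [dotProduct, Fin.sum_univ_three, J_zero, J_one, J_two]; ring) w.ofLp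
  have h3 : x.1.ofLp ⬝ᵥ w.ofLp = 0 := by
    simp only [dotProduct, Fin.sum_univ_three]; linarith
  have h4 := congrFun this i
  rw [h3] at h4
  simp only [dotProduct, Fin.sum_univ_three, Pi.add_apply, Pi.smul_apply, smul_eq_mul,
    zero_mul, add_zero] at h4
  rw [inner_E3, inner_E3]
  exact h4

/-- Both vectors are unit vectors in one plane, so the complex number whose argument defines the
angle has modulus 1. -/
lemma IsUnitTangent.exp_angle {x : S2} {v w : E3} (hv : IsUnitTangent x v)
    (hw : IsUnitTangent x w) :
    Complex.exp (Complex.I * angle x v w) = inner ℝ v w + Complex.I * inner ℝ (J x v) w := by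
  have h0 := hv.decomp hw 0
  have h1 := hv.decomp hw 1
  have h2 := hv.decomp hw 2
  set A := inner ℝ v w with hA
  set B := inner ℝ (J x v) w with hB
  have hAB : A ^ 2 + B ^ 2 = 1 := by
    have : A * A + B * B = 1 := by
      have hA' := hA
      have hB' := hB
      rw [inner_E3] at hA' hB'
      linear_combination A * hA' + B * hB' - (w 0 * h0 + w 1 * h1 + w 2 * h2) + hw.1
    linarith
  have hn : ‖(⟨A, B⟩ : ℂ)‖ = 1 := by
    rw [Complex.norm_def, Real.sqrt_eq_one, Complex.normSq_mk]; linarith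
  have := Complex.norm_mul_exp_arg_mul_I ⟨A, B⟩
  rw [hn] at this
  rw [angle, mul_comm, ← hA, ← hB]
  simp only [Complex.ofReal_one, one_mul] at this
  rw [this]
  apply Complex.ext <;> simp

/-- If w = Av + B Jv then Jw = A Jv - Bv, whence Jw + iw = (A + iB)(Jv + iv). Angles between
reference directions thus become scalar phases. -/
lemma IsUnitTangent.tvec_eq {x : S2} {v w : E3} (hv : IsUnitTangent x v)
    (hw : IsUnitTangent x w) :
    tvec x w = Complex.exp (Complex.I * angle x v w) • tvec x v := by
  rw [hv.exp_angle hw]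
  have h := hv.decomp hw
  set A := inner ℝ v w with hA
  set B := inner ℝ (J x v) w with hB
  have hx := sum_sq_eq_one x
  have hvx := hv.2
  have hJ : ∀ i, J x w i = A * J x v i - B * v i := by
    intro i
    have h0 := h 0
    have h1 := h 1
    have h2 := h 2
    simp only [J_zero, J_one, J_two] at h0 h1 h2
    fin_cases i
    · simp only [Fin.zero_eta, Fin.mk_one, Fin.reduceFinMk, J_zero, J_one, J_two, h0, h1, h2]
      linear_combination B * x.1 0 * hvx - B * v 0 * hx
    · simp only [Fin.zero_eta, Fin.mk_one, Fin.reduceFinMk, J_zero, J_one, J_two, h0, h1, h2]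
      linear_combination B * x.1 1 * hvx - B * v 1 * hx
    · simp only [Fin.zero_eta, Fin.mk_one, Fin.reduceFinMk, J_zero, J_one, J_two, h0, h1, h2]
      linear_combination B * x.1 2 * hvx - B * v 2 * hx
  ext i
  rw [Pi.smul_apply, tvec_apply, tvec_apply, hJ, h i]
  push_cast
  rw [smul_eq_mul]
  linear_combination -(B * v i : ℂ) * Complex.I_sq

/-! ### Equivariance of tangent frames under rotations -/

/-- Paired with u, both sides are det(Mu, Mv, Mw) up to the order of the vectors. For a rotation it
shows that the cross product, and so `J`, is equivariant. -/
lemma transpose_cross_mulVec (M : Matrix (Fin 3) (Fin 3) ℝ) (v w : Fin 3 → ℝ) :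
    M.transpose.mulVec (crossProduct (M.mulVec v) (M.mulVec w)) = M.det • crossProduct v w := by
  ext i
  fin_cases i <;>
  · simp [Matrix.mulVec, dotProduct, Fin.sum_univ_three, cross_apply, Matrix.det_fin_three]
    ring

lemma J_rot (R : SO3) (x : S2) (v : E3) : J (rot R x) (rotVec R v) = rotVec R (J x v) := by
  have h := transpose_cross_mulVec R.1 v.ofLp x.1.ofLp
  rw [R.det_eq_one, one_smul] at h
  have h2 := congrArg R.1.mulVec h
  rw [Matrix.mulVec_mulVec, R.mul_transpose, Matrix.one_mulVec] at h2
  simp only [J, rotVec, rot, h2]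

/-- The action of a rotation on complex vectors. -/
def rotC (R : SO3) (w : Fin 3 → ℂ) : Fin 3 → ℂ := fun i =>
  R.1 i 0 * w 0 + R.1 i 1 * w 1 + R.1 i 2 * w 2

lemma cvec_rotVec (R : SO3) (v : E3) : cvec (rotVec R v) = rotC R (cvec v) := by
  ext i; simp [cvec, rotC, rotVec_apply]

lemma tvec_rot (R : SO3) (x : S2) (v : E3) :
    tvec (rot R x) (rotVec R v) = rotC R (tvec x v) := by
  rw [tvec, J_rot, cvec_rotVec, cvec_rotVec, tvec]
  ext i; simp [rotC]; ring

lemma IsUnitTangent.rot {x : S2} {v : E3} (hv : IsUnitTangent x v) (R : SO3) :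
    IsUnitTangent (rot R x) (rotVec R v) := by
  have h : ∀ v w : E3, (rotVec R v).ofLp ⬝ᵥ (rotVec R w).ofLp = v.ofLp ⬝ᵥ w.ofLp := by
    intro v w
    simp only [rotVec]
    rw [Matrix.dotProduct_mulVec, Matrix.vecMul_mulVec, R.transpose_mul, Matrix.vecMul_one]
  have h1 := h v v
  have h2 := h v x.1
  simp only [dotProduct, Fin.sum_univ_three] at h1 h2
  exact ⟨by linarith [hv.1], by rw [rot_coe]; linarith [hv.2]⟩

lemma cos_lon_mul (x : S2) : Real.sqrt (x.1 0 ^ 2 + x.1 1 ^ 2) * Real.cos (lon x) = x.1 0 := by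
  have := Complex.norm_mul_cos_arg (⟨x.1 0, x.1 1⟩ : ℂ)
  rwa [Complex.norm_def, Complex.normSq_mk, ← sq, ← sq] at this

lemma sin_lon_mul (x : S2) : Real.sqrt (x.1 0 ^ 2 + x.1 1 ^ 2) * Real.sin (lon x) = x.1 1 := by
  have := Complex.norm_mul_sin_arg (⟨x.1 0, x.1 1⟩ : ℂ)
  rwa [Complex.norm_def, Complex.normSq_mk, ← sq, ← sq] at this

lemma isUnitTangent_rhoI (x : S2) : IsUnitTangent x (rhoI x) := by
  constructor
  · simp [rhoI]
  · simp only [rhoI, PiLp.toLp_apply, Matrix.cons_val]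
    linear_combination Real.sin (lon x) * cos_lon_mul x - Real.cos (lon x) * sin_lon_mul x

lemma isUnitTangent_rho (R : SO3) (x : S2) : IsUnitTangent x (rho R x) := by
  simpa [rho] using (isUnitTangent_rhoI (rot R⁻¹ x)).rot R

/-- The complex vector `e_θ + i e_φ` of the coordinates `(θ_R, φ_R)` at `x`. -/
def frame (R : SO3) (x : S2) : Fin 3 → ℂ := tvec x (rho R x)

/-- The source of every spin transition law below. It needs no membership in `U`, since `rho` is a
unit tangent vector even where the longitude takes its default value. -/
lemma frame_eq (R₁ R₂ : SO3) (x : S2) :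
    frame R₂ x = Complex.exp (Complex.I * psi x R₂ R₁) • frame R₁ x :=
  (isUnitTangent_rho R₁ x).tvec_eq (isUnitTangent_rho R₂ x)

lemma rho_rot (R R' : SO3) (x : S2) : rho (R * R') (rot R x) = rotVec R (rho R' x) := by
  rw [rho, rho, rotVec_mul, ← rot_mul]
  simp [mul_assoc]

lemma frame_rot (R R' : SO3) (x : S2) : frame (R * R') (rot R x) = rotC R (frame R' x) := by
  rw [frame, rho_rot, tvec_rot, frame]

/-! ### Spherical coordinates -/

/-- At the poles the sine of the colatitude vanishes, so the default longitude does no harm. -/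
lemma sphPoint_colat_lon (x : S2) : sphPoint (colat x) (lon x) = x := by
  have hx := sum_sq_eq_one x
  have h2 : Real.cos (colat x) = x.1 2 :=
    Real.cos_arccos (by nlinarith [sq_nonneg (x.1 0), sq_nonneg (x.1 1)])
      (by nlinarith [sq_nonneg (x.1 0), sq_nonneg (x.1 1)])
  have h1 : Real.sin (colat x) = Real.sqrt (x.1 0 ^ 2 + x.1 1 ^ 2) := by
    rw [colat, Real.sin_arccos]; congr 1; linarith
  apply Subtype.ext
  ext i
  fin_cases i <;> simp [sphPoint, h1, h2, cos_lon_mul, sin_lon_mul]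

/-- The vector `e_θ + i e_φ` at the point with spherical coordinates `(θ, φ)`. -/
def sphFrame (t u : ℝ) : Fin 3 → ℂ :=
  ![Complex.cos t * Complex.cos u - Complex.I * Complex.sin u,
    Complex.cos t * Complex.sin u + Complex.I * Complex.cos u, -Complex.sin t]

lemma tvec_sphPoint (t u : ℝ) :
    tvec (sphPoint t u) !₂[-Real.sin u, Real.cos u, 0] = sphFrame t u := by
  ext i
  rw [tvec_apply]
  fin_cases i
  · simp [J_zero, sphFrame, sphPoint]; ring
  · simp [J_one, sphFrame, sphPoint]; ring
  · simp [J_two, sphFrame, sphPoint]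
    linear_combination (-Complex.sin t) * Complex.sin_sq_add_cos_sq u

lemma isUnitTangent_sphPoint (t u : ℝ) :
    IsUnitTangent (sphPoint t u) !₂[-Real.sin u, Real.cos u, 0] := by
  constructor
  · simp
  · simp [sphPoint]; ring

/-- The longitude may differ from `u` by a multiple of 2π, but only its sine and cosine enter. -/
lemma rhoI_sphPoint {t : ℝ} (ht : 0 < Real.sin t) (u : ℝ) :
    rhoI (sphPoint t u) = !₂[-Real.sin u, Real.cos u, 0] := by
  have h : (sphPoint t u).1 0 ^ 2 + (sphPoint t u).1 1 ^ 2 = Real.sin t ^ 2 := by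
    simp only [sphPoint, PiLp.toLp_apply, Matrix.cons_val]
    linear_combination Real.sin t ^ 2 * Real.sin_sq_add_cos_sq u
  have hc := cos_lon_mul (sphPoint t u)
  have hs := sin_lon_mul (sphPoint t u)
  rw [h, Real.sqrt_sq ht.le] at hc hs
  simp only [sphPoint, PiLp.toLp_apply, Matrix.cons_val] at hc hs
  have hc' := mul_left_cancel₀ ht.ne' hc
  have hs' := mul_left_cancel₀ ht.ne' hs
  unfold rhoI
  simp only [sphPoint]
  rw [hc', hs']

lemma frame_sphPoint (R : SO3) {t : ℝ} (ht : 0 < Real.sin t) (u : ℝ) :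
    frame R (rot R (sphPoint t u)) = rotC R (sphFrame t u) := by
  have := frame_rot R 1 (sphPoint t u)
  rw [mul_one] at this
  rw [this, frame, rho, inv_one, rot_one, rotVec_one, rhoI_sphPoint ht, tvec_sphPoint]

/-- Here `t`, `u` are the unrotated coordinates: for every `R` the frame is a phase times one
explicit vector, which reduces pointwise identities to a computation in half angles. -/
lemma exists_frame_eq (R : SO3) (x : S2) :
    ∃ t u c : ℝ, x = sphPoint t u ∧ frame R x = Complex.exp (Complex.I * c) • sphFrame t u := by
  refine ⟨colat x, lon x, angle x !₂[-Real.sin (lon x), Real.cos (lon x), 0] (rho R x),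
    (sphPoint_colat_lon x).symm, ?_⟩
  have h := isUnitTangent_sphPoint (colat x) (lon x)
  have h2 := tvec_sphPoint (colat x) (lon x)
  rw [sphPoint_colat_lon] at h h2
  rw [← h2]
  exact h.tvec_eq (isUnitTangent_rho R x)

lemma sin_colat_pos_of_mem_U {R : SO3} {x : S2} (hx : x ∈ U R) : 0 < Real.sin (colatR R x) := by
  rw [mem_U_iff] at hx
  set y := rot R⁻¹ x with hy
  have hy1 := sum_sq_eq_one y
  have h1 : Real.sin (colatR R x) = Real.sqrt (y.1 0 ^ 2 + y.1 1 ^ 2) := by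
    rw [colatR, colat, Real.sin_arccos]; congr 1; linarith
  rw [h1, Real.sqrt_pos]
  by_contra hcon
  have h0 : y.1 0 = 0 := by nlinarith [sq_nonneg (y.1 0), sq_nonneg (y.1 1)]
  have h1 : y.1 1 = 0 := by nlinarith [sq_nonneg (y.1 0), sq_nonneg (y.1 1)]
  have h2 : (y.1 2 - 1) * (y.1 2 + 1) = 0 := by rw [h0, h1] at hy1; linarith
  rcases mul_eq_zero.1 h2 with h | h
  · apply hx.1
    apply Subtype.ext; ext i
    fin_cases i <;> simp [northPole, h0, h1]; linarith
  · apply hx.2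
    apply Subtype.ext; ext i
    fin_cases i <;> simp [southPole, h0, h1]; linarith

lemma rot_sphPoint_coords (R : SO3) (x : S2) :
    rot R (sphPoint (colatR R x) (lonR R x)) = x := by
  rw [colatR, lonR, sphPoint_colat_lon, rot_rot_inv]

lemma rot_sphPoint_mem_U (R : SO3) {t : ℝ} (ht : 0 < Real.sin t) (u : ℝ) :
    rot R (sphPoint t u) ∈ U R := by
  rw [mem_U_iff, rot_inv_rot]
  have h : (sphPoint t u).1 0 ^ 2 + (sphPoint t u).1 1 ^ 2 ≠ 0 := by
    have : (sphPoint t u).1 0 ^ 2 + (sphPoint t u).1 1 ^ 2 = Real.sin t ^ 2 := by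
      simp only [sphPoint, PiLp.toLp_apply, Matrix.cons_val]
      linear_combination Real.sin t ^ 2 * Real.sin_sq_add_cos_sq u
    rw [this]; positivity
  constructor <;> intro hh <;> apply h <;> rw [hh] <;> simp [northPole, southPole]

/-! ### The spin raising and lowering operators on powers of linear forms -/

/-- The witness is Rᵀa: the rotation moves onto the constant vector, and derivatives are taken in
the standard coordinates. -/
lemma exists_rotC_adjoint (R : SO3) (a : Fin 3 → ℂ) :
    ∃ b : Fin 3 → ℂ, ∀ w, rotC R w ⬝ᵥ a = w ⬝ᵥ b := by
  refine ⟨fun j => R.1 0 j * a 0 + R.1 1 j * a 1 + R.1 2 j * a 2, fun w => ?_⟩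
  simp [rotC, dotProduct, Fin.sum_univ_three]; ring

/-- The complexified point with spherical coordinates `(θ, φ)`. -/
def sphC (t u : ℝ) : Fin 3 → ℂ :=
  ![Complex.sin t * Complex.cos u, Complex.sin t * Complex.sin u, Complex.cos t]

lemma cvec_sphPoint (t u : ℝ) : cvec (sphPoint t u).1 = sphC t u := by
  ext i; fin_cases i <;> simp [cvec, sphPoint, sphC]

lemma hasDerivAt_csin (t : ℝ) :
    HasDerivAt (fun t : ℝ => Complex.sin (t : ℂ)) (Complex.cos t) t :=
  (Complex.hasDerivAt_sin t).comp_ofReal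

lemma hasDerivAt_ccos (t : ℝ) :
    HasDerivAt (fun t : ℝ => Complex.cos (t : ℂ)) (-Complex.sin t) t :=
  (Complex.hasDerivAt_cos t).comp_ofReal

lemma hasDerivAt_vec3_dotProduct {f₀ f₁ f₂ : ℝ → ℂ} {d₀ d₁ d₂ : ℂ} {t : ℝ}
    (h₀ : HasDerivAt f₀ d₀ t) (h₁ : HasDerivAt f₁ d₁ t) (h₂ : HasDerivAt f₂ d₂ t)
    (b : Fin 3 → ℂ) :
    HasDerivAt (fun t => ![f₀ t, f₁ t, f₂ t] ⬝ᵥ b) (![d₀, d₁, d₂] ⬝ᵥ b) t := by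
  simp only [dotProduct, Fin.sum_univ_three, Matrix.cons_val]
  exact ((h₀.mul_const _).add (h₁.mul_const _)).add (h₂.mul_const _)

lemma hasDerivAt_sphC_fst (t u : ℝ) (b : Fin 3 → ℂ) :
    HasDerivAt (fun t => sphC t u ⬝ᵥ b)
      (![Complex.cos t * Complex.cos u, Complex.cos t * Complex.sin u, -Complex.sin t] ⬝ᵥ b) t :=
  hasDerivAt_vec3_dotProduct ((hasDerivAt_csin t).mul_const _) ((hasDerivAt_csin t).mul_const _)
    (hasDerivAt_ccos t) b

lemma hasDerivAt_sphC_snd (t u : ℝ) (b : Fin 3 → ℂ) :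
    HasDerivAt (fun u => sphC t u ⬝ᵥ b)
      (![Complex.sin t * -Complex.sin u, Complex.sin t * Complex.cos u, 0] ⬝ᵥ b) u :=
  hasDerivAt_vec3_dotProduct ((hasDerivAt_ccos u).const_mul _) ((hasDerivAt_csin u).const_mul _)
    (hasDerivAt_const _ _) b

lemma hasDerivAt_sphFrame_fst (t u : ℝ) (b : Fin 3 → ℂ) :
    HasDerivAt (fun t => sphFrame t u ⬝ᵥ b)
      (![-Complex.sin t * Complex.cos u, -Complex.sin t * Complex.sin u, -Complex.cos t] ⬝ᵥ b) t :=
  hasDerivAt_vec3_dotProduct (((hasDerivAt_ccos t).mul_const _).sub_const _)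
    (((hasDerivAt_ccos t).mul_const _).add_const _) (hasDerivAt_csin t).neg b

lemma hasDerivAt_sphFrame_snd (t u : ℝ) (b : Fin 3 → ℂ) :
    HasDerivAt (fun u => sphFrame t u ⬝ᵥ b)
      (![Complex.cos t * -Complex.sin u - Complex.I * Complex.cos u,
        Complex.cos t * Complex.cos u + Complex.I * -Complex.sin u, 0] ⬝ᵥ b) u :=
  hasDerivAt_vec3_dotProduct
    (((hasDerivAt_ccos u).const_mul _).sub ((hasDerivAt_csin u).const_mul _))
    (((hasDerivAt_csin u).const_mul _).add ((hasDerivAt_ccos u).const_mul _))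
    (hasDerivAt_const _ _) b

lemma hasDerivAt_pow_mul_pow {f g : ℝ → ℂ} {f' g' : ℂ} {t : ℝ} (hf : HasDerivAt f f' t)
    (hg : HasDerivAt g g' t) (p n : ℕ) :
    HasDerivAt (fun t => f t ^ p * g t ^ n)
      (p * f t ^ (p - 1) * f' * g t ^ n + f t ^ p * (n * g t ^ (n - 1) * g')) t :=
  (hf.pow p).mul (hg.pow n)

/-- Leibniz rule with two inputs: the operator ∂_θ + (i/sin θ)∂_φ maps x to m and m to cot θ · m.
The term n cot θ coming from the n-th power of m·a cancels against the derivative of (sin θ)^{-n}.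
The vectors a are arbitrary; isotropy plays no role. -/
lemma edth_sum_pow {ι : Type*} (S : Finset ι) (c : ι → ℂ) (a : ι → Fin 3 → ℂ) (p n : ℕ)
    (f : Family) (R : SO3)
    (hf : ∀ x ∈ U R, f R x =
      ∑ i ∈ S, c i * ((cvec x.1 ⬝ᵥ a i) ^ p * (frame R x ⬝ᵥ a i) ^ n))
    {x : S2} (hx : x ∈ U R) :
    edth n f R x =
      ∑ i ∈ S, (-(p : ℂ) * c i) *
        ((cvec x.1 ⬝ᵥ a i) ^ (p - 1) * (frame R x ⬝ᵥ a i) ^ (n + 1)) := by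
  choose b hb using fun i => exists_rotC_adjoint R (a i)
  have hs := sin_colat_pos_of_mem_U hx
  have hxx := rot_sphPoint_coords R x
  unfold edth
  set t := colatR R x
  set u := lonR R x
  have hf' : ∀ t u : ℝ, 0 < Real.sin t → f R (rot R (sphPoint t u)) =
      ∑ i ∈ S, c i * ((sphC t u ⬝ᵥ b i) ^ p * (sphFrame t u ⬝ᵥ b i) ^ n) := by
    intro t u ht
    rw [hf _ (rot_sphPoint_mem_U R ht u), frame_sphPoint R ht, rot_coe, cvec_rotVec,
      cvec_sphPoint]
    simp only [hb]
  have hsC : Complex.sin (t : ℂ) ≠ 0 := by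
    rw [← Complex.ofReal_sin]; exact_mod_cast hs.ne'
  have hz : HasDerivAt (fun t : ℝ => (Real.sin t : ℂ) ^ (-(n : ℤ)))
      (((-(n : ℤ) : ℤ) : ℂ) * Complex.sin t ^ (-(n : ℤ) - 1) * Complex.cos t) t := by
    have h1 : HasDerivAt (fun t : ℂ => Complex.sin t ^ (-(n : ℤ)))
        (((-(n : ℤ) : ℤ) : ℂ) * Complex.sin t ^ (-(n : ℤ) - 1) * Complex.cos t) (t : ℂ) :=
      (hasDerivAt_zpow _ _ (Or.inl hsC)).comp (t : ℂ) (Complex.hasDerivAt_sin t)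
    simpa using h1.comp_ofReal
  have hd1 := hz.fun_mul (HasDerivAt.fun_sum (u := S) fun i _ =>
    (hasDerivAt_pow_mul_pow (hasDerivAt_sphC_fst t u (b i))
      (hasDerivAt_sphFrame_fst t u (b i)) p n).const_mul (c i))
  have hd2 := (HasDerivAt.fun_sum (u := S) fun i _ =>
    (hasDerivAt_pow_mul_pow (hasDerivAt_sphC_snd t u (b i))
      (hasDerivAt_sphFrame_snd t u (b i)) p n).const_mul (c i)).const_mul
      ((Real.sin t : ℂ) ^ (-(n : ℤ)))
  -- The formula for `f` is known only where the sine is positive, so in the colatitude the two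
  -- functions agree only near the point.
  have he1 : (fun t : ℝ => (Real.sin t : ℂ) ^ (-(n : ℤ)) * f R (rot R (sphPoint t u)))
      =ᶠ[nhds t] fun t : ℝ => (Real.sin t : ℂ) ^ (-(n : ℤ)) *
        ∑ i ∈ S, c i * ((sphC t u ⬝ᵥ b i) ^ p * (sphFrame t u ⬝ᵥ b i) ^ n) := by
    have : ∀ᶠ t' in nhds t, 0 < Real.sin t' :=
      Real.continuous_sin.continuousAt.eventually (lt_mem_nhds hs)
    filter_upwards [this] with t' ht'
    rw [hf' t' u ht']
  have he2 : (fun u : ℝ => (Real.sin t : ℂ) ^ (-(n : ℤ)) * f R (rot R (sphPoint t u)))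
      = fun u : ℝ => (Real.sin t : ℂ) ^ (-(n : ℤ)) *
        ∑ i ∈ S, c i * ((sphC t u ⬝ᵥ b i) ^ p * (sphFrame t u ⬝ᵥ b i) ^ n) := by
    funext u
    rw [hf' t u hs]
  rw [he1.deriv_eq, he2]
  have hd1' := hd1.deriv
  have hd2' := hd2.deriv
  rw [hd1', hd2']
  have hR : ∀ i ∈ S, (-(p : ℂ) * c i) *
      ((cvec x.1 ⬝ᵥ a i) ^ (p - 1) * (frame R x ⬝ᵥ a i) ^ (n + 1)) =
      (-(p : ℂ) * c i) * ((sphC t u ⬝ᵥ b i) ^ (p - 1) * (sphFrame t u ⬝ᵥ b i) ^ (n + 1)) := by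
    intro i _
    rw [← hxx, frame_sphPoint R hs, rot_coe, cvec_rotVec, cvec_sphPoint, hb, hb]
  rw [Finset.sum_congr rfl hR]
  have hzn : Complex.sin (t : ℂ) ^ (n : ℤ) * Complex.sin (t : ℂ) ^ (-(n : ℤ)) = 1 := by
    rw [← zpow_add₀ hsC]; simp
  have hzn1 : Complex.sin (t : ℂ) ^ (n : ℤ) * Complex.sin (t : ℂ) ^ (-(n : ℤ) - 1)
      = (Complex.sin (t : ℂ))⁻¹ := by
    rw [← zpow_add₀ hsC, ← zpow_neg_one]; congr 1; ring
  rw [Complex.ofReal_sin]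
  have key : ∀ A B D E F I' : ℂ,
      -(Complex.sin (t : ℂ) ^ (n : ℤ)) * ((A * Complex.sin (t : ℂ) ^ (-(n : ℤ) - 1) * B * D +
        Complex.sin (t : ℂ) ^ (-(n : ℤ)) * E) + I' * (Complex.sin (t : ℂ) ^ (-(n : ℤ)) * F)) =
      -(A * (Complex.sin (t : ℂ))⁻¹ * B * D + E + I' * F) := by
    intro A B D E F I'
    rw [← hzn1]
    linear_combination (-E - I' * F) * hzn
  rw [key]
  simp only [Finset.mul_sum]
  rw [← Finset.sum_add_distrib, ← Finset.sum_add_distrib, ← Finset.sum_neg_distrib]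
  refine Finset.sum_congr rfl fun i _ => ?_
  -- The operator takes the position vector to e_θ + i e_φ.
  have hY : (![Complex.cos t * Complex.cos u, Complex.cos t * Complex.sin u, -Complex.sin t] ⬝ᵥ b i)
      + Complex.I / Complex.sin t *
        (![Complex.sin t * -Complex.sin u, Complex.sin t * Complex.cos u, 0] ⬝ᵥ b i)
      = sphFrame t u ⬝ᵥ b i := by
    simp only [sphFrame, dotProduct, Fin.sum_univ_three, Matrix.cons_val]
    field_simp
    ring
  -- The operator multiplies e_θ + i e_φ by cot θ; the radial components cancel because i² = -1.
  have hM : (![-Complex.sin t * Complex.cos u, -Complex.sin t * Complex.sin u, -Complex.cos t]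
        ⬝ᵥ b i) + Complex.I / Complex.sin t *
      (![Complex.cos t * -Complex.sin u - Complex.I * Complex.cos u,
        Complex.cos t * Complex.cos u + Complex.I * -Complex.sin u, 0] ⬝ᵥ b i)
      = Complex.cos t * (Complex.sin t)⁻¹ * (sphFrame t u ⬝ᵥ b i) := by
    simp only [sphFrame, dotProduct, Fin.sum_univ_three, Matrix.cons_val]
    field_simp
    linear_combination (-Complex.cos u * b i 0 - Complex.sin u * b i 1) * Complex.I_sq +
      (-Complex.cos u * b i 0 - Complex.sin u * b i 1) * Complex.sin_sq_add_cos_sq (t : ℂ)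
  -- For n = 0 the truncated exponent n - 1 is harmless because of the factor n.
  have hn : (n : ℂ) * (sphFrame t u ⬝ᵥ b i) ^ (n - 1) * (sphFrame t u ⬝ᵥ b i)
      = n * (sphFrame t u ⬝ᵥ b i) ^ n := by
    rcases n with _ | n
    · simp
    · rw [Nat.add_sub_cancel, pow_succ]; ring
  push_cast
  set y := sphC t u ⬝ᵥ b i
  set m := sphFrame t u ⬝ᵥ b i
  linear_combination (-c i * p * y ^ (p - 1) * m ^ n) * hY
    - c i * y ^ p * n * m ^ (n - 1) * hM - c i * y ^ p * Complex.cos t * (Complex.sin t)⁻¹ * hn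

lemma raise_sum_pow {ι : Type*} (S : Finset ι) (c : ι → ℂ) (a : ι → Fin 3 → ℂ) (l n : ℕ)
    (R : SO3) {x : S2} (hx : x ∈ U R) :
    raise n (toFamily fun x => ∑ i ∈ S, c i * (cvec x.1 ⬝ᵥ a i) ^ l) R x =
      ∑ i ∈ S, ((-1) ^ n * (l.descFactorial n : ℂ) * c i) *
        ((cvec x.1 ⬝ᵥ a i) ^ (l - n) * (frame R x ⬝ᵥ a i) ^ n) := by
  induction n generalizing x with
  | zero => simp [raise, toFamily]
  | succ n ih =>
    rw [raise, edth_sum_pow S _ a (l - n) n _ R (fun x hx => ih hx) hx]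
    refine Finset.sum_congr rfl fun i _ => ?_
    rw [Nat.descFactorial_succ, Nat.sub_sub]
    push_cast
    ring

/-! ### Conjugation and the lowering operator -/

lemma edth_smul (s : ℤ) (c : ℂ) (f : Family) : edth s (c • f) = c • edth s f := by
  funext R x
  simp only [edth, Pi.smul_apply, smul_eq_mul, mul_left_comm _ c, deriv_const_mul_field]
  ring

lemma conjF_conjF (f : Family) : conjF (conjF f) = f := by
  funext R x; simp [conjF]

/-- Inner conjugations cancel in pairs, which reduces lowering to raising. -/
lemma lower_eq (n : ℕ) (f : Family) :
    lower n f = ((-1 : ℂ) ^ n) • conjF (raise n (conjF f)) := by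
  induction n with
  | zero => simp [lower, raise, conjF_conjF]
  | succ n ih =>
    rw [lower, ih, edthBar, raise]
    have : conjF ((-1 : ℂ) ^ n • conjF (raise n (conjF f))) =
        (-1 : ℂ) ^ n • raise n (conjF f) := by
      funext R x; simp [conjF]
    rw [this, edth_smul, neg_neg]
    funext R x
    simp [conjF, pow_succ]

lemma star_dotProduct_fin_three (v w : Fin 3 → ℂ) : star (v ⬝ᵥ w) = star v ⬝ᵥ star w := by
  simp [dotProduct, Fin.sum_univ_three]

lemma star_cvec (v : E3) : star (cvec v) = cvec v := by
  ext i; simp [cvec]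

lemma lower_sum_pow {ι : Type*} (S : Finset ι) (c : ι → ℂ) (a : ι → Fin 3 → ℂ) (l n : ℕ)
    (R : SO3) {x : S2} (hx : x ∈ U R) :
    lower n (toFamily fun x => ∑ i ∈ S, c i * (cvec x.1 ⬝ᵥ a i) ^ l) R x =
      ∑ i ∈ S, ((l.descFactorial n : ℂ) * c i) *
        ((cvec x.1 ⬝ᵥ a i) ^ (l - n) * (star (frame R x) ⬝ᵥ a i) ^ n) := by
  have h1 : conjF (toFamily fun x => ∑ i ∈ S, c i * (cvec x.1 ⬝ᵥ a i) ^ l) =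
      toFamily fun x => ∑ i ∈ S, star (c i) * (cvec x.1 ⬝ᵥ star (a i)) ^ l := by
    funext R x
    simp only [conjF, toFamily, starRingEnd_apply, star_sum, star_mul', star_pow,
      star_dotProduct_fin_three, star_cvec]
  rw [lower_eq, h1]
  simp only [Pi.smul_apply, conjF]
  rw [raise_sum_pow S _ _ l n R hx]
  simp only [starRingEnd_apply, star_sum, star_mul', star_pow, smul_eq_mul, Finset.mul_sum]
  refine Finset.sum_congr rfl fun i _ => ?_
  have h2 : star (cvec x.1 ⬝ᵥ star (a i)) = cvec x.1 ⬝ᵥ a i := by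
    rw [star_dotProduct_fin_three, star_star, star_cvec]
  have h3 : star (frame R x ⬝ᵥ star (a i)) = star (frame R x) ⬝ᵥ a i := by
    rw [star_dotProduct_fin_three, star_star]
  rw [h2, h3]
  simp only [star_neg, star_one, star_natCast, star_star]
  have h4 : ((-1 : ℂ) ^ n) * (-1) ^ n = 1 := by rw [← mul_pow]; simp
  linear_combination ((l.descFactorial n : ℂ) * c i *
    ((cvec x.1 ⬝ᵥ a i) ^ (l - n) * (star (frame R x) ⬝ᵥ a i) ^ n)) * h4

section

open Polynomial

/-! ### Spin harmonics as coefficients of products of quadratic polynomials -/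

/-- The quadratic polynomial `w ⬝ ((1 - z²)/2, i(1 + z²)/2, z)` in `z`; the vectors on the right are
the isotropic ones. -/
def quad (w : Fin 3 → ℂ) : ℂ[X] :=
  C ((w 0 + Complex.I * w 1) / 2) + C (w 2) * X - C ((w 0 - Complex.I * w 1) / 2) * X ^ 2

/-- The isotropic vector with parameter `z`. -/
def isoVec (z : ℂ) : Fin 3 → ℂ := ![(1 - z ^ 2) / 2, Complex.I * (1 + z ^ 2) / 2, z]

lemma eval_quad (w : Fin 3 → ℂ) (z : ℂ) : (quad w).eval z = w ⬝ᵥ isoVec z := by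
  simp [quad, isoVec, dotProduct, Fin.sum_univ_three]; ring

lemma natDegree_quad_le (w : Fin 3 → ℂ) : (quad w).natDegree ≤ 2 := by
  unfold quad; compute_degree

lemma quad_smul (c : ℂ) (w : Fin 3 → ℂ) : quad (c • w) = C c * quad w := by
  apply Polynomial.funext
  intro z
  rw [eval_mul, eval_quad, eval_quad, eval_C, smul_dotProduct, smul_eq_mul]

lemma natDegree_quad_pow_mul_le (v w : Fin 3 → ℂ) (p n : ℕ) :
    (quad v ^ p * quad w ^ n).natDegree ≤ 2 * (p + n) := by
  refine natDegree_mul_le.trans ?_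
  have h1 := (natDegree_pow_le (p := quad v) (n := p)).trans
    (Nat.mul_le_mul_left p (natDegree_quad_le v))
  have h2 := (natDegree_pow_le (p := quad w) (n := n)).trans
    (Nat.mul_le_mul_left n (natDegree_quad_le w))
  omega

/-- Linear polynomials `a + bz`. -/
def lin (a b : ℂ) : ℂ[X] := C a + C b * X

/-- The first of the two spinors at the point with spherical coordinates `(θ, φ)`. -/
def spinorA (t u : ℝ) : ℂ[X] :=
  lin (Complex.sin (t / 2) * Complex.exp (Complex.I * (u / 2)))
    (Complex.cos (t / 2) * Complex.exp (-(Complex.I * (u / 2))))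

/-- The second of the two spinors at the point with spherical coordinates `(θ, φ)`. -/
def spinorB (t u : ℝ) : ℂ[X] :=
  lin (Complex.cos (t / 2) * Complex.exp (Complex.I * (u / 2)))
    (-Complex.sin (t / 2) * Complex.exp (-(Complex.I * (u / 2))))

lemma cos_add_I_sin (u : ℝ) :
    Complex.cos u + Complex.I * Complex.sin u = Complex.exp (Complex.I * (u / 2)) ^ 2 := by
  rw [mul_comm Complex.I (Complex.sin _), ← Complex.exp_mul_I, ← Complex.exp_nat_mul]
  congr 1; push_cast; ring

lemma cos_sub_I_sin (u : ℝ) :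
    Complex.cos u - Complex.I * Complex.sin u = Complex.exp (-(Complex.I * (u / 2))) ^ 2 := by
  have := cos_add_I_sin (-u)
  push_cast at this
  rw [Complex.cos_neg, Complex.sin_neg, neg_div, mul_neg, mul_neg] at this
  rw [← this]; ring

lemma exp_mul_exp_neg_half (u : ℝ) :
    Complex.exp (Complex.I * (u / 2)) * Complex.exp (-(Complex.I * (u / 2))) = 1 := by
  rw [← Complex.exp_add]; simp

lemma sin_half (t : ℝ) :
    Complex.sin t = 2 * Complex.sin (t / 2) * Complex.cos (t / 2) := by
  rw [← Complex.sin_two_mul]; congr 1; ring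

lemma cos_half (t : ℝ) :
    Complex.cos t = Complex.cos (t / 2) ^ 2 - Complex.sin (t / 2) ^ 2 := by
  rw [← Complex.cos_two_mul']; congr 1; ring

lemma eval_lin (a b z : ℂ) : (lin a b).eval z = a + b * z := by simp [lin]

/-- The discriminant of `quad w` is w·w. It is 1 for a point of the sphere, giving two linear
factors, and 0 for e_θ ± i e_φ, which is why `quad_sphFrame` and `quad_star_sphFrame` give squares
up to sign. -/
lemma quad_sphC (t u : ℝ) : quad (sphC t u) = spinorA t u * spinorB t u := by
  apply Polynomial.funext
  intro z
  simp only [eval_quad, eval_mul, spinorA, spinorB, eval_lin, sphC, isoVec, dotProduct,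
    Fin.sum_univ_three, Matrix.cons_val]
  rw [sin_half t, cos_half t]
  have h1 := cos_add_I_sin u
  have h2 := cos_sub_I_sin u
  have h3 := exp_mul_exp_neg_half u
  set E := Complex.exp (Complex.I * (u / 2))
  set E' := Complex.exp (-(Complex.I * (u / 2)))
  set S := Complex.sin (t / 2)
  set K := Complex.cos (t / 2)
  linear_combination (S * K) * h1 - (S * K) * z ^ 2 * h2 + (S ^ 2 - K ^ 2) * z * h3

lemma quad_sphFrame (t u : ℝ) : quad (sphFrame t u) = -spinorA t u ^ 2 := by
  apply Polynomial.funext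
  intro z
  simp only [eval_quad, eval_mul, eval_neg, eval_pow, spinorA, eval_lin, sphFrame, isoVec,
    dotProduct, Fin.sum_univ_three, Matrix.cons_val]
  rw [sin_half t, cos_half t]
  have h1 := cos_add_I_sin u
  have h2 := cos_sub_I_sin u
  have h3 := exp_mul_exp_neg_half u
  have h4 := Complex.sin_sq_add_cos_sq (t / 2 : ℂ)
  set E := Complex.exp (Complex.I * (u / 2))
  set E' := Complex.exp (-(Complex.I * (u / 2)))
  set S := Complex.sin (t / 2)
  set K := Complex.cos (t / 2)
  have e1 : Complex.cos u = (E ^ 2 + E' ^ 2) / 2 := by linear_combination (h1 + h2) / 2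
  have e2 : Complex.sin u = -Complex.I * (E ^ 2 - E' ^ 2) / 2 := by
    linear_combination (-Complex.I) * (h1 - h2) / 2 + Complex.sin u * Complex.I_sq
  have e3 : K ^ 2 = 1 - S ^ 2 := by linear_combination h4
  rw [e1, e2]
  have h5 : K ^ 2 - S ^ 2 = 1 - 2 * S ^ 2 := by rw [e3]; ring
  rw [h5]
  ring_nf
  simp only [Complex.I_sq, e3]
  linear_combination (2 * S * K * z) * h3

lemma quad_star_sphFrame (t u : ℝ) : quad (star (sphFrame t u)) = spinorB t u ^ 2 := by
  have hs : star (sphFrame t u) = ![Complex.cos t * Complex.cos u + Complex.I * Complex.sin u,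
      Complex.cos t * Complex.sin u - Complex.I * Complex.cos u, -Complex.sin t] := by
    ext i
    fin_cases i <;>
      simp [sphFrame, ← Complex.ofReal_sin, ← Complex.ofReal_cos, Complex.conj_ofReal] <;> ring
  rw [hs]
  apply Polynomial.funext
  intro z
  simp only [eval_quad, eval_mul, eval_neg, eval_pow, spinorB, eval_lin, isoVec,
    dotProduct, Fin.sum_univ_three, Matrix.cons_val]
  rw [sin_half t, cos_half t]
  have h1 := cos_add_I_sin u
  have h2 := cos_sub_I_sin u
  have h3 := exp_mul_exp_neg_half u
  have h4 := Complex.sin_sq_add_cos_sq (t / 2 : ℂ)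
  set E := Complex.exp (Complex.I * (u / 2))
  set E' := Complex.exp (-(Complex.I * (u / 2)))
  set S := Complex.sin (t / 2)
  set K := Complex.cos (t / 2)
  have e1 : Complex.cos u = (E ^ 2 + E' ^ 2) / 2 := by linear_combination (h1 + h2) / 2
  have e2 : Complex.sin u = -Complex.I * (E ^ 2 - E' ^ 2) / 2 := by
    linear_combination (-Complex.I) * (h1 - h2) / 2 + Complex.sin u * Complex.I_sq
  have e3 : K ^ 2 = 1 - S ^ 2 := by linear_combination h4
  rw [e1, e2]
  have h5 : K ^ 2 - S ^ 2 = 1 - 2 * S ^ 2 := by rw [e3]; ring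
  rw [h5]
  ring_nf
  simp only [Complex.I_sq, e3]
  linear_combination (2 * S * K * z) * h3

/-! ### Spherical harmonics by a generating polynomial -/

/-- The normalising constant of `Y_{lm}`. -/
def constY (l : ℕ) (m : ℤ) : ℝ :=
  (-1 : ℝ) ^ (-m).toNat *
    (Real.sqrt (((l + m).toNat.factorial : ℝ) * ((l - m).toNat.factorial : ℝ) * (2 * l + 1)
        / (4 * Real.pi)) / (l.factorial : ℝ))

lemma coeff_lin_pow_mul_lin_pow (a b c d : ℂ) (l k : ℕ) :
    (lin a b ^ l * lin c d ^ l).coeff k =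
      ∑ p ∈ (Finset.range (l + 1) ×ˢ Finset.range (l + 1)).filter
          (fun p => (p.1 : ℤ) - (p.2 : ℤ) = l - k),
        (l.choose p.1 : ℂ) * (l.choose p.2 : ℂ) *
          (c ^ p.1 * d ^ (l - p.1) * (b ^ p.2 * a ^ (l - p.2))) := by
  have h1 : lin a b ^ l = ∑ j ∈ Finset.range (l + 1),
      C (b ^ j * a ^ (l - j) * (l.choose j : ℂ)) * X ^ j := by
    rw [lin, add_comm, add_pow]
    refine Finset.sum_congr rfl fun j _ => ?_
    simp only [mul_pow, map_mul, map_pow, map_natCast]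
    ring
  have h2 : lin c d ^ l = ∑ r ∈ Finset.range (l + 1),
      C (c ^ r * d ^ (l - r) * (l.choose r : ℂ)) * X ^ (l - r) := by
    rw [lin, add_pow]
    refine Finset.sum_congr rfl fun j _ => ?_
    simp only [mul_pow, map_mul, map_pow, map_natCast]
    ring
  rw [h1, h2, mul_comm, Finset.sum_mul_sum, ← Finset.sum_product', finsetSum_coeff,
    Finset.sum_filter]
  refine Finset.sum_congr rfl fun p hp => ?_
  simp only [Finset.mem_product, Finset.mem_range] at hp
  rw [show C (c ^ p.1 * d ^ (l - p.1) * (l.choose p.1 : ℂ)) * X ^ (l - p.1) *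
      (C (b ^ p.2 * a ^ (l - p.2) * (l.choose p.2 : ℂ)) * X ^ p.2) =
      C ((c ^ p.1 * d ^ (l - p.1) * (l.choose p.1 : ℂ)) *
        (b ^ p.2 * a ^ (l - p.2) * (l.choose p.2 : ℂ))) * X ^ (l - p.1 + p.2) by
    simp only [C_mul, pow_add]; ring]
  rw [coeff_C_mul_X_pow]
  have : (k = l - p.1 + p.2) ↔ ((p.1 : ℤ) - (p.2 : ℤ) = l - k) := by omega
  simp only [this]
  split_ifs
  · ring
  · rfl

/-- The defining sum over pairs (r, j) is the binomial expansion of A^l B^l. The power of z is l - r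
+ j, so r - j = m selects degree l - m, and the half-angle exponentials combine to e^{imφ}. -/
lemma Y_eq_coeff (l : ℕ) {m : ℤ} (hm : m ∈ Set.Icc (-(l : ℤ)) l) (x : S2) :
    Y l m x = constY l m * (quad (cvec x.1) ^ l).coeff (l - m).toNat := by
  conv_rhs => rw [← sphPoint_colat_lon x, cvec_sphPoint, quad_sphC, mul_pow, spinorA, spinorB,
    coeff_lin_pow_mul_lin_pow]
  rw [Y, constY]
  set t := colat x
  set u := lon x
  obtain ⟨hm1, hm2⟩ := hm
  have hk : ((l : ℤ) - ((l - m).toNat : ℤ)) = m := by omega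
  rw [hk]
  push_cast
  rw [← mul_assoc, mul_comm (Complex.exp _), mul_assoc]
  congr 1
  rw [Finset.mul_sum]
  refine Finset.sum_congr rfl fun p hp => ?_
  simp only [Finset.mem_filter, Finset.mem_product, Finset.mem_range] at hp
  obtain ⟨⟨hp1, hp2⟩, hp3⟩ := hp
  have hE : Complex.exp (Complex.I * m * u) =
      Complex.exp (Complex.I * (u / 2)) ^ p.1 * Complex.exp (-(Complex.I * (u / 2))) ^ (l - p.1)
      * (Complex.exp (-(Complex.I * (u / 2))) ^ p.2 *
        Complex.exp (Complex.I * (u / 2)) ^ (l - p.2)) := by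
    simp only [← Complex.exp_nat_mul, ← Complex.exp_add]
    congr 1
    rw [Nat.cast_sub (by omega), Nat.cast_sub (by omega), ← hp3]
    push_cast
    ring
  have hS : 2 * l - p.1 - p.2 = (l - p.1) + (l - p.2) := by omega
  rw [hE, hS, pow_add, pow_add]
  simp only [mul_pow]
  rw [neg_pow (Complex.sin _)]
  ring

/-- Lagrange interpolation at 0, …, N-1. It writes a coefficient as a finite sum of powers of linear
forms, to which `edth_sum_pow` applies. -/
lemma exists_coeff_eq_sum_eval (N k : ℕ) :
    ∃ c : ℕ → ℂ, ∀ P : ℂ[X], P.natDegree < N →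
      P.coeff k = ∑ i ∈ Finset.range N, c i * P.eval (i : ℂ) := by
  refine ⟨fun i => (Lagrange.basis (Finset.range N) (fun i : ℕ => (i : ℂ)) i).coeff k,
    fun P hP => ?_⟩
  have hinj : Set.InjOn (fun i : ℕ => (i : ℂ)) (Finset.range N) :=
    fun _ _ _ _ h => Nat.cast_injective h
  have hdeg : P.degree < (Finset.range N).card := by
    rw [Finset.card_range]
    exact (degree_le_natDegree).trans_lt (by exact_mod_cast hP)
  conv_lhs => rw [Lagrange.eq_interpolate hinj hdeg]
  rw [Lagrange.interpolate_apply, finsetSum_coeff]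
  refine Finset.sum_congr rfl fun i _ => ?_
  rw [coeff_C_mul, mul_comm]

/-- The frame vector of spin `±1`, according to the sign of `s`. -/
def frameS (s : ℤ) (R : SO3) (x : S2) : Fin 3 → ℂ :=
  if 0 ≤ s then frame R x else star (frame R x)

/-- The polynomial whose coefficients are multiples of the `ₛY_{lm}`. -/
def spinPoly (l : ℕ) (s : ℤ) (R : SO3) (x : S2) : ℂ[X] :=
  quad (cvec x.1) ^ (l - s.natAbs) * quad (frameS s R x) ^ s.natAbs

/-- The constant of proportionality in `spinY_eq`. -/
def spinConst (s : ℤ) (l : ℕ) (m : ℤ) : ℝ :=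
  Real.sqrt (((l - s.natAbs).factorial : ℝ) / ((l + s.natAbs).factorial : ℝ)) *
    ((if 0 ≤ s then (-1) ^ s.natAbs else 1) * l.descFactorial s.natAbs) * constY l m

lemma spinY_eq {s : ℤ} {l : ℕ} (hs : s.natAbs ≤ l) {m : ℤ} (hm : m ∈ Set.Icc (-(l : ℤ)) l)
    {R : SO3} {x : S2} (hx : x ∈ U R) :
    spinY s l m R x = spinConst s l m * (spinPoly l s R x).coeff (l - m).toNat := by
  -- The same weights serve before and after differentiation, since both polynomials have degree at
  -- most 2l.
  obtain ⟨c, hc⟩ := exists_coeff_eq_sum_eval (2 * l + 1) (l - m).toNat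
  have hY : Y l m = fun x : S2 => ∑ i ∈ Finset.range (2 * l + 1),
      (constY l m * c i) * (cvec x.1 ⬝ᵥ isoVec i) ^ l := by
    funext x
    have hd := natDegree_quad_pow_mul_le (cvec x.1) (cvec x.1) l 0
    rw [pow_zero, mul_one] at hd
    rw [Y_eq_coeff l hm, hc _ (by omega), Finset.mul_sum]
    refine Finset.sum_congr rfl fun i _ => ?_
    rw [eval_pow, eval_quad]; ring
  have hd : (spinPoly l s R x).natDegree < 2 * l + 1 := by
    have := natDegree_quad_pow_mul_le (cvec x.1) (frameS s R x) (l - s.natAbs) s.natAbs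
    rw [spinPoly]; omega
  rw [hc _ hd]
  simp only [spinY, Pi.smul_apply, spinConst, smul_eq_mul, spinPoly, frameS, eval_mul, eval_pow,
    eval_quad]
  rw [hY]
  split_ifs with h
  · rw [raise_sum_pow _ _ _ l _ R hx]
    push_cast
    simp only [Finset.mul_sum]
    refine Finset.sum_congr rfl fun i _ => ?_
    ring
  · rw [lower_sum_pow _ _ _ l _ R hx]
    push_cast
    simp only [Finset.mul_sum]
    refine Finset.sum_congr rfl fun i _ => ?_
    ring

end

section

open Polynomial

/-! ### The unitarily invariant norm of binary forms and the diagonal of the kernel -/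

/-- Nonnegative arguments suffice, which allows the substitution t = T² in `gram_diag`. -/
lemma coeff_eq_of_sum_pow_eq {n : ℕ} {a b : ℕ → ℂ}
    (h : ∀ t : ℝ, 0 ≤ t → ∑ i ∈ Finset.range (n + 1), a i * (t : ℂ) ^ i =
      ∑ i ∈ Finset.range (n + 1), b i * (t : ℂ) ^ i) {i : ℕ} (hi : i ≤ n) : a i = b i := by
  have key : ∑ i ∈ Finset.range (n + 1), C (a i) * X ^ i =
      ∑ i ∈ Finset.range (n + 1), C (b i) * X ^ i := by
    apply Polynomial.eq_of_infinite_eval_eq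
    refine Set.Infinite.mono (s := (fun t : ℝ => (t : ℂ)) '' Set.Ici 0) ?_
      ((Set.Ici_infinite 0).image Complex.ofReal_injective.injOn)
    rintro _ ⟨t, ht, rfl⟩
    simpa [eval_finsetSum] using h t ht
  have := congrArg (fun p => p.coeff i) key
  simpa [finsetSum_coeff, coeff_C_mul_X_pow, Nat.lt_succ_of_le hi] using this

lemma coeff_lin_pow (p q : ℂ) (n k : ℕ) :
    (lin p q ^ n).coeff k = (n.choose k : ℂ) * (p ^ (n - k) * q ^ k) := by
  have h1 : lin p q ^ n = ∑ j ∈ Finset.range (n + 1),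
      C (q ^ j * p ^ (n - j) * (n.choose j : ℂ)) * X ^ j := by
    rw [lin, add_comm, add_pow]
    refine Finset.sum_congr rfl fun j _ => ?_
    simp only [mul_pow, map_mul, map_pow, map_natCast]
    ring
  rw [h1, finsetSum_coeff]
  simp only [coeff_C_mul_X_pow, Finset.sum_ite_eq, Finset.mem_range]
  split_ifs with h
  · ring
  · rw [Nat.choose_eq_zero_of_lt (by omega)]; simp

/-- With weights 1/C(n,k), the pairing of the n-th powers of two linear forms is the n-th power of
the pairing of the forms. Applied to A + tB and A + rB with A, B orthonormal it gives (1 + tr)^n;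
the coefficient of t^j r^j is the claim. -/
lemma sum_coeff_mul_star_coeff {a b c d : ℂ} (hab : a * star a + b * star b = 1)
    (hcd : c * star c + d * star d = 1) (hac : a * star c + b * star d = 0) {n j : ℕ}
    (hj : j ≤ n) :
    ∑ k ∈ Finset.range (n + 1), (lin a b ^ (n - j) * lin c d ^ j).coeff k *
      star ((lin a b ^ (n - j) * lin c d ^ j).coeff k) / (n.choose k : ℂ) =
      1 / (n.choose j : ℂ) := by
  set W : ℕ → ℕ → ℂ := fun j k => (lin a b ^ (n - j) * lin c d ^ j).coeff k with hW
  have hca : c * star a + d * star b = 0 := by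
    have := congrArg star hac
    simp only [star_add, star_mul', star_star, star_zero] at this
    linear_combination this
  have hexp : ∀ (t : ℝ) (k : ℕ), (n.choose k : ℂ) * ((a + t * c) ^ (n - k) * (b + t * d) ^ k) =
      ∑ i ∈ Finset.range (n + 1), ((n.choose i : ℂ) * W i k) * (t : ℂ) ^ i := by
    intro t k
    rw [← coeff_lin_pow]
    have : lin (a + t * c) (b + t * d) = C (t : ℂ) * lin c d + lin a b := by
      simp only [lin, C_add, C_mul]; ring
    rw [this, add_pow, finsetSum_coeff]
    refine Finset.sum_congr rfl fun i _ => ?_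
    have e : (C (t : ℂ) * lin c d) ^ i * lin a b ^ (n - i) * ((n.choose i : ℕ) : ℂ[X]) =
        C ((t : ℂ) ^ i * (n.choose i : ℂ)) * (lin a b ^ (n - i) * lin c d ^ i) := by
      simp only [mul_pow, map_mul, map_pow, map_natCast]
      ring
    rw [e, coeff_C_mul]
    simp only [hW]; ring
  have hgen : ∀ t r : ℝ, ∑ k ∈ Finset.range (n + 1),
      (∑ i ∈ Finset.range (n + 1), ((n.choose i : ℂ) * W i k) * (t : ℂ) ^ i) *
      star (∑ i ∈ Finset.range (n + 1), ((n.choose i : ℂ) * W i k) * (r : ℂ) ^ i) /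
        (n.choose k : ℂ) = (t * r + 1) ^ n := by
    intro t r
    have h1 : (t : ℂ) * r + 1 = (b + t * d) * star (b + r * d) + (a + t * c) * star (a + r * c) := by
      have hr : star (r : ℂ) = r := Complex.conj_ofReal r
      simp only [star_add, star_mul', hr]
      linear_combination -hab - t * r * hcd - r * hac - t * hca
    rw [h1, add_pow]
    refine Finset.sum_congr rfl fun k hk => ?_
    rw [← hexp, ← hexp]
    have hc : (n.choose k : ℂ) ≠ 0 := by
      exact_mod_cast (Nat.choose_pos (by simpa [Nat.lt_succ_iff] using hk)).ne'
    simp only [star_mul', star_pow, star_natCast, mul_pow]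
    field_simp
  -- Coefficient of t^j with r fixed; the coefficient of r^j is taken afterwards in `h4`.
  have h2 : ∀ r : ℝ, ∑ k ∈ Finset.range (n + 1), W j k *
      star (∑ i ∈ Finset.range (n + 1), ((n.choose i : ℂ) * W i k) * (r : ℂ) ^ i) /
        (n.choose k : ℂ) = (r : ℂ) ^ j := by
    intro r
    have hcj : (n.choose j : ℂ) ≠ 0 := by exact_mod_cast (Nat.choose_pos hj).ne'
    apply mul_left_cancel₀ hcj
    refine coeff_eq_of_sum_pow_eq (n := n)
      (a := fun j => (n.choose j : ℂ) * ∑ k ∈ Finset.range (n + 1), W j k *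
      star (∑ i ∈ Finset.range (n + 1), ((n.choose i : ℂ) * W i k) * (r : ℂ) ^ i) /
        (n.choose k : ℂ)) (b := fun j => (n.choose j : ℂ) * (r : ℂ) ^ j) (fun t _ => ?_) hj
    have h3 : ∑ i ∈ Finset.range (n + 1), (n.choose i : ℂ) * (r : ℂ) ^ i * (t : ℂ) ^ i =
        (t * r + 1) ^ n := by
      rw [add_pow]
      refine Finset.sum_congr rfl fun i _ => ?_
      rw [mul_pow]; ring
    rw [h3, ← hgen t r]
    simp only [Finset.mul_sum, Finset.sum_mul, Finset.sum_div]
    rw [Finset.sum_comm]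
    refine Finset.sum_congr rfl fun k _ => Finset.sum_congr rfl fun i _ => ?_
    ring
  have hcj : (n.choose j : ℂ) ≠ 0 := by exact_mod_cast (Nat.choose_pos hj).ne'
  apply mul_left_cancel₀ hcj
  rw [mul_one_div_cancel hcj]
  have h4 := coeff_eq_of_sum_pow_eq (n := n)
      (a := fun i => (n.choose i : ℂ) * ∑ k ∈ Finset.range (n + 1), W j k *
      star (W i k) / (n.choose k : ℂ)) (b := fun i => if i = j then 1 else 0) (fun r _ => ?_) hj
  · simpa using h4
  · have h5 : ∑ i ∈ Finset.range (n + 1), (if i = j then (1 : ℂ) else 0) * (r : ℂ) ^ i =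
        (r : ℂ) ^ j := by
      simp [Nat.lt_succ_of_le hj]
    rw [h5, ← h2 r]
    have hr : star (r : ℂ) = r := Complex.conj_ofReal r
    simp only [star_sum, star_mul', star_pow, star_natCast, hr, Finset.mul_sum, Finset.sum_mul,
      Finset.sum_div]
    rw [Finset.sum_comm]
    refine Finset.sum_congr rfl fun k _ => Finset.sum_congr rfl fun i _ => ?_
    ring

lemma star_exp_I_mul (c : ℝ) : star (Complex.exp (Complex.I * c)) = Complex.exp (-(Complex.I * c)) := by
  change (starRingEnd ℂ) _ = _
  rw [← Complex.exp_conj]; simp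

lemma exp_I_mul_star (c : ℝ) :
    Complex.exp (Complex.I * c) * star (Complex.exp (Complex.I * c)) = 1 := by
  rw [star_exp_I_mul, ← Complex.exp_add]; simp

/-- The exponents are l + s and l - s for either sign of s: m contributes A², its conjugate B², and
each x contributes AB. -/
lemma spinPoly_eq {l : ℕ} {s : ℤ} (hs : s.natAbs ≤ l) (R : SO3) (x : S2) :
    ∃ (t u : ℝ) (κ : ℂ), κ * star κ = 1 ∧
      spinPoly l s R x =
        C κ * (spinorA t u ^ (2 * l - (l - s).toNat) * spinorB t u ^ (l - s).toNat) := by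
  obtain ⟨t, u, c, hx, hf⟩ := exists_frame_eq R x
  have hκ := exp_I_mul_star c
  set κ := Complex.exp (Complex.I * c) with hκd
  rw [spinPoly, hx, cvec_sphPoint, quad_sphC, ← hx]
  rcases le_or_gt 0 s with h | h
  · refine ⟨t, u, (-κ) ^ s.natAbs, ?_, ?_⟩
    · rw [star_pow, ← mul_pow, star_neg, neg_mul_neg, hκ, one_pow]
    · rw [frameS, if_pos h, hf, quad_smul, quad_sphFrame, C_pow, C_neg]
      have h1 : 2 * l - (l - s).toNat = (l - s.natAbs) + 2 * s.natAbs := by omega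
      have h2 : (l - s).toNat = l - s.natAbs := by omega
      rw [h1, h2, mul_neg, ← neg_mul, mul_pow, mul_pow, pow_add, pow_mul]
      ring
  · refine ⟨t, u, (star κ) ^ s.natAbs, ?_, ?_⟩
    · rw [star_pow, ← mul_pow, star_star, mul_comm, hκ, one_pow]
    · rw [frameS, if_neg (not_le.2 h), hf, star_smul, quad_smul, quad_star_sphFrame, C_pow]
      have h1 : 2 * l - (l - s).toNat = l - s.natAbs := by omega
      have h2 : (l - s).toNat = (l - s.natAbs) + 2 * s.natAbs := by omega
      rw [h1, h2, mul_pow, mul_pow, pow_add, pow_mul]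
      ring

lemma star_sin_ofReal (t : ℝ) : star (Complex.sin (t / 2)) = Complex.sin (t / 2) := by
  change (starRingEnd ℂ) _ = _
  rw [← Complex.sin_conj, map_div₀, Complex.conj_ofReal, map_ofNat]

lemma star_cos_ofReal (t : ℝ) : star (Complex.cos (t / 2)) = Complex.cos (t / 2) := by
  change (starRingEnd ℂ) _ = _
  rw [← Complex.cos_conj, map_div₀, Complex.conj_ofReal, map_ofNat]

lemma sum_spinPoly_coeff {l : ℕ} {s : ℤ} (hs : s.natAbs ≤ l) (R : SO3) (x : S2) :
    ∑ k ∈ Finset.range (2 * l + 1), (spinPoly l s R x).coeff k *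
      star ((spinPoly l s R x).coeff k) / ((2 * l).choose k : ℂ) =
      1 / ((2 * l).choose (l - s).toNat : ℂ) := by
  obtain ⟨t, u, κ, hκ, h⟩ := spinPoly_eq hs R x
  have hE := exp_mul_exp_neg_half u
  have e1 : star (Complex.exp (Complex.I * (u / 2))) = Complex.exp (-(Complex.I * (u / 2))) := by
    simpa using star_exp_I_mul (u / 2)
  have e2 : star (Complex.exp (-(Complex.I * (u / 2)))) = Complex.exp (Complex.I * (u / 2)) := by
    rw [← e1, star_star]
  have h4 := Complex.sin_sq_add_cos_sq (t / 2 : ℂ)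
  have := sum_coeff_mul_star_coeff (n := 2 * l) (j := (l - s).toNat)
    (a := Complex.sin (t / 2) * Complex.exp (Complex.I * (u / 2)))
    (b := Complex.cos (t / 2) * Complex.exp (-(Complex.I * (u / 2))))
    (c := Complex.cos (t / 2) * Complex.exp (Complex.I * (u / 2)))
    (d := -Complex.sin (t / 2) * Complex.exp (-(Complex.I * (u / 2))))
    (by
      simp only [star_mul', star_neg, star_sin_ofReal, star_cos_ofReal, e1, e2]
      linear_combination h4 + hE * (Complex.sin (t / 2) ^ 2 + Complex.cos (t / 2) ^ 2))
    (by
      simp only [star_mul', star_neg, star_sin_ofReal, star_cos_ofReal, e1, e2]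
      linear_combination h4 + hE * (Complex.sin (t / 2) ^ 2 + Complex.cos (t / 2) ^ 2))
    (by
      simp only [star_mul', star_neg, star_sin_ofReal, star_cos_ofReal, e1, e2]
      ring) (by omega)
  rw [← this]
  refine Finset.sum_congr rfl fun k _ => ?_
  rw [h, coeff_C_mul, star_mul']
  simp only [spinorA, spinorB]
  set w := (lin (Complex.sin (t / 2) * Complex.exp (Complex.I * (u / 2)))
    (Complex.cos (t / 2) * Complex.exp (-(Complex.I * (u / 2)))) ^ (2 * l - (l - s).toNat) *
    lin (Complex.cos (t / 2) * Complex.exp (Complex.I * (u / 2)))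
    (-Complex.sin (t / 2) * Complex.exp (-(Complex.I * (u / 2)))) ^ (l - s).toNat).coeff k
  linear_combination (w * star w / ((2 * l).choose k : ℂ)) * hκ

/-! ### Normalising constants and the constant diagonal -/

/-- The dependence on m is exactly the weight 1/C(2l,l-m) of the invariant norm, and the factor
C(2l,l-s) cancels the value in `sum_spinPoly_coeff`. -/
lemma spinConst_sq {s : ℤ} {l : ℕ} (hs : s.natAbs ≤ l) {m : ℤ} (hm : m ∈ Set.Icc (-(l : ℤ)) l) :
    spinConst s l m ^ 2 = ((2 * l).choose (l - s).toNat : ℝ) * ((2 * l + 1) / (4 * Real.pi)) /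
      ((2 * l).choose (l - m).toNat : ℝ) := by
  obtain ⟨hm1, hm2⟩ := hm
  have hsgn : ((if 0 ≤ s then (-1) ^ s.natAbs else 1 : ℝ)) ^ 2 = 1 := by
    split_ifs
    · rw [← pow_mul, mul_comm, pow_mul]; simp
    · simp
  have hsgn2 : ((-1 : ℝ) ^ (-m).toNat) ^ 2 = 1 := by
    rw [← pow_mul, mul_comm, pow_mul]; simp
  have hpi := Real.pi_pos
  have hsq1 := Real.sq_sqrt (show (0 : ℝ) ≤ ((l - s.natAbs).factorial : ℝ) /
    ((l + s.natAbs).factorial : ℝ) by positivity)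
  have hsq2 := Real.sq_sqrt (show (0 : ℝ) ≤ ((l + m).toNat.factorial : ℝ) *
    ((l - m).toNat.factorial : ℝ) * (2 * l + 1) / (4 * Real.pi) by positivity)
  rw [spinConst, constY]
  simp only [mul_pow, div_pow]
  rw [hsq1, hsq2, hsgn, hsgn2]
  have hd : ((l - s.natAbs).factorial : ℝ) * l.descFactorial s.natAbs = l.factorial := by
    exact_mod_cast Nat.factorial_mul_descFactorial hs
  have hc1 : ((2 * l).choose (l - m).toNat : ℝ) * (l - m).toNat.factorial *
      (l + m).toNat.factorial = (2 * l).factorial := by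
    have := Nat.choose_mul_factorial_mul_factorial (n := 2 * l) (k := (l - m).toNat) (by omega)
    rw [show 2 * l - (l - m).toNat = (l + m).toNat by omega] at this
    exact_mod_cast this
  have hc2 : ((2 * l).choose (l - s).toNat : ℝ) * (l - s.natAbs).factorial *
      (l + s.natAbs).factorial = (2 * l).factorial := by
    have := Nat.choose_mul_factorial_mul_factorial (n := 2 * l) (k := (l - s).toNat) (by omega)
    rcases le_or_gt 0 s with h | h
    · rw [show 2 * l - (l - s).toNat = l + s.natAbs by omega,
        show (l - s).toNat = l - s.natAbs by omega] at this
      rw [show (l - s).toNat = l - s.natAbs by omega]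
      exact_mod_cast this
    · rw [show 2 * l - (l - s).toNat = l - s.natAbs by omega,
        show (l - s).toNat = l + s.natAbs by omega] at this
      rw [show (l - s).toNat = l + s.natAbs by omega, mul_right_comm]
      exact_mod_cast this
  have p1 : (0 : ℝ) < (l - s.natAbs).factorial := by positivity
  have p2 : (0 : ℝ) < (l + s.natAbs).factorial := by positivity
  have p3 : (0 : ℝ) < l.factorial := by positivity
  have p4 : (0 : ℝ) < (2 * l).choose (l - m).toNat := by
    exact_mod_cast Nat.choose_pos (by omega)
  have h5 : (l.descFactorial s.natAbs : ℝ) = l.factorial / (l - s.natAbs).factorial := by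
    field_simp; linarith
  have h6 : ((2 * l).choose (l - s).toNat : ℝ) = (2 * l).choose (l - m).toNat *
      (l - m).toNat.factorial * (l + m).toNat.factorial /
      ((l - s.natAbs).factorial * (l + s.natAbs).factorial) := by
    field_simp; linarith
  rw [h5, h6]
  field_simp

/-- The function on all of `S²` given by the formula for `(ₛY_{lm})_R` on `U_R`. -/
def harm (s : ℤ) (l : ℕ) (m : ℤ) (R : SO3) (x : S2) : ℂ :=
  spinConst s l m * (spinPoly l s R x).coeff (l - m).toNat

lemma sum_Icc_eq_sum_range {M : Type*} [AddCommMonoid M] (l : ℕ) (F : ℕ → M) :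
    ∑ m ∈ Finset.Icc (-(l : ℤ)) l, F (l - m).toNat = ∑ k ∈ Finset.range (2 * l + 1), F k := by
  refine Finset.sum_nbij' (fun m => (l - m).toNat) (fun k => (l : ℤ) - k) ?_ ?_ ?_ ?_ ?_
  · intro m hm; simp only [Finset.mem_Icc, Finset.mem_range] at *; omega
  · intro m hm; simp only [Finset.mem_Icc, Finset.mem_range] at *; omega
  · intro m hm; simp only [Finset.mem_Icc] at *; omega
  · intro m hm; simp only [Finset.mem_range] at *; omega
  · intro m _; rfl

lemma sum_harm_mul_star {l : ℕ} {s : ℤ} (hs : s.natAbs ≤ l) (R : SO3) (x : S2) :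
    ∑ m ∈ Finset.Icc (-(l : ℤ)) l, harm s l m R x * star (harm s l m R x) =
      (2 * (l : ℂ) + 1) / (4 * (Real.pi : ℂ)) := by
  set F : ℕ → ℂ := fun k => (((2 * l).choose (l - s).toNat : ℂ) * ((2 * l + 1) / (4 * Real.pi))) *
    ((spinPoly l s R x).coeff k * star ((spinPoly l s R x).coeff k) /
      ((2 * l).choose k : ℂ)) with hF
  have h1 : ∀ m ∈ Finset.Icc (-(l : ℤ)) l, harm s l m R x * star (harm s l m R x) =
      F (l - m).toNat := by
    intro m hm
    rw [hF]
    have := congrArg (fun r : ℝ => (r : ℂ)) (spinConst_sq hs (m := m) (by simpa using hm))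
    push_cast at this
    have hr : star (spinConst s l m : ℂ) = spinConst s l m := Complex.conj_ofReal _
    simp only [harm, star_mul', hr]
    set w := (spinPoly l s R x).coeff (l - m).toNat
    linear_combination (w * star w) * this
  rw [Finset.sum_congr rfl h1, sum_Icc_eq_sum_range l F, hF, ← Finset.mul_sum, sum_spinPoly_coeff hs]
  have hc : ((2 * l).choose (l - s).toNat : ℂ) ≠ 0 := by
    exact_mod_cast (Nat.choose_pos (by omega)).ne'
  field_simp

/-- One term of a nonnegative sum whose value is at most 1. This uniform bound gives square
integrability on a finite measure space. -/
lemma norm_spinPoly_coeff_sq_le {l : ℕ} {s : ℤ} (hs : s.natAbs ≤ l) {k : ℕ} (hk : k ≤ 2 * l)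
    (R : SO3) (x : S2) : ‖(spinPoly l s R x).coeff k‖ ^ 2 ≤ (2 * l).choose k := by
  have h := sum_spinPoly_coeff hs R x
  have h1 : ∀ k, (spinPoly l s R x).coeff k * star ((spinPoly l s R x).coeff k) /
      ((2 * l).choose k : ℂ) =
      ((‖(spinPoly l s R x).coeff k‖ ^ 2 / (2 * l).choose k : ℝ) : ℂ) := by
    intro k
    rw [Complex.star_def, Complex.mul_conj, Complex.normSq_eq_norm_sq]
    push_cast
    rfl
  simp only [h1] at h
  have h2 : ∑ k ∈ Finset.range (2 * l + 1),
      ‖(spinPoly l s R x).coeff k‖ ^ 2 / ((2 * l).choose k : ℝ) =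
      1 / ((2 * l).choose (l - s).toNat : ℝ) := by
    apply Complex.ofReal_injective
    rw [Complex.ofReal_sum, h]
    push_cast
    rfl
  have h3 := Finset.single_le_sum (s := Finset.range (2 * l + 1))
    (f := fun k => ‖(spinPoly l s R x).coeff k‖ ^ 2 / ((2 * l).choose k : ℝ))
    (fun _ _ => by positivity) (Finset.mem_range.2 (Nat.lt_succ_of_le hk))
  rw [h2] at h3
  have h4 : (1 : ℝ) ≤ (2 * l).choose (l - s).toNat := by
    exact_mod_cast Nat.choose_pos (by omega)
  have h5 : (0 : ℝ) < (2 * l).choose k := by exact_mod_cast Nat.choose_pos hk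
  have h6 := h3.trans ((div_le_one (by linarith)).2 h4)
  rwa [div_le_one h5] at h6

end

section

open MeasureTheory
open scoped Pointwise

/-! ### Surface measure -/

/-- A rotation as a linear isometry. -/
def rotIso (R : SO3) : E3 ≃ₗᵢ[ℝ] E3 where
  toFun := rotVec R
  invFun := rotVec R⁻¹
  left_inv v := by rw [← rotVec_mul, inv_mul_cancel, rotVec_one]
  right_inv v := by rw [← rotVec_mul, mul_inv_cancel, rotVec_one]
  map_add' v w := by simp [rotVec, Matrix.mulVec_add]
  map_smul' c v := by simp [rotVec, Matrix.mulVec_smul]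
  norm_map' := norm_rotVec R

lemma rotIso_apply (R : SO3) (v : E3) : rotIso R v = rotVec R v := rfl

lemma continuous_rot (R : SO3) : Continuous (rot R) :=
  Continuous.subtype_mk ((rotIso R).continuous.comp continuous_subtype_val) _

/-- A rotation as a homeomorphism of the sphere. -/
def rotHomeo (R : SO3) : S2 ≃ₜ S2 where
  toFun := rot R
  invFun := rot R⁻¹
  left_inv := rot_inv_rot R
  right_inv := rot_rot_inv R
  continuous_toFun := continuous_rot R
  continuous_invFun := continuous_rot R⁻¹

lemma measurePreserving_rot (R : SO3) : MeasurePreserving (rot R) dS dS := by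
  refine ⟨(continuous_rot R).measurable, ?_⟩
  ext s hs
  have hs' : MeasurableSet (rot R ⁻¹' s) := (continuous_rot R).measurable hs
  rw [Measure.map_apply (continuous_rot R).measurable hs, dS, Measure.toSphere_apply' _ hs,
    Measure.toSphere_apply' _ hs']
  congr 1
  -- Surface measure is a multiple of the volume of the open cone over a set, and cones commute with
  -- rotations, which preserve Lebesgue measure.
  have h : Set.Ioo (0 : ℝ) 1 • ((↑) '' (rot R ⁻¹' s) : Set E3) =
      rotIso R ⁻¹' (Set.Ioo (0 : ℝ) 1 • ((↑) '' s : Set E3)) := by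
    ext v
    simp only [Set.mem_smul, Set.mem_image, Set.mem_preimage]
    constructor
    · rintro ⟨c, hc, _, ⟨y, hy, rfl⟩, rfl⟩
      exact ⟨c, hc, _, ⟨_, hy, rfl⟩, by rw [map_smul]; rfl⟩
    · rintro ⟨c, hc, _, ⟨y, hy, rfl⟩, h⟩
      refine ⟨c, hc, _, ⟨rot R⁻¹ y, by simpa using hy, rfl⟩, ?_⟩
      apply (rotIso R).injective
      rw [← h, map_smul, rotIso_apply, ← rot_coe, rot_rot_inv]
  rw [h]
  exact (rotIso R).measurePreserving.measure_preimage_equiv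
    (f := (rotIso R).toHomeomorph.toMeasurableEquiv) _

lemma integral_rot (R : SO3) (g : S2 → ℂ) : ∫ x, g (rot R x) ∂dS = ∫ x, g x ∂dS :=
  (measurePreserving_rot R).integral_comp (rotHomeo R).measurableEmbedding g

instance : IsFiniteMeasure dS := by unfold dS; infer_instance

lemma dS_real_univ : dS.real Set.univ = 4 * Real.pi := by
  rw [dS, Measure.toSphere_real_apply_univ, measureReal_def, EuclideanSpace.volume_ball_fin_three]
  rw [finrank_euclideanSpace_fin, ENNReal.ofReal_one, one_pow, one_mul,
    ENNReal.toReal_ofReal (by positivity)]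
  push_cast
  ring

/-- The cone over a point lies in a line, a null set. Hence the omitted poles never affect an
integral. -/
lemma dS_singleton (x : S2) : dS {x} = 0 := by
  rw [dS, Measure.toSphere_apply' _ (measurableSet_singleton x)]
  have h : volume (Set.Ioo (0 : ℝ) 1 • ((↑) '' ({x} : Set S2) : Set E3)) = 0 := by
    refine measure_mono_null (t := (Submodule.span ℝ {x.1} : Set E3)) ?_
      (Measure.addHaar_submodule _ _ ?_)
    · rintro _ ⟨c, _, _, ⟨y, hy, rfl⟩, rfl⟩
      rw [Set.mem_singleton_iff.1 hy]
      exact Submodule.smul_mem _ _ (Submodule.mem_span_singleton_self _)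
    · intro h
      have h1 := finrank_span_singleton (K := ℝ) (ne_zero_of_mem_unit_sphere x)
      rw [h, finrank_top, finrank_euclideanSpace_fin] at h1
      omega
  rw [h, mul_zero]

lemma U_compl_subset (R : SO3) : (U R)ᶜ ⊆ {rot R northPole, rot R southPole} := by
  intro x hx
  rw [Set.mem_compl_iff, mem_U_iff, not_and_or, not_not, not_not] at hx
  rcases hx with h | h
  · left; rw [← h, rot_rot_inv]
  · right; rw [Set.mem_singleton_iff, ← h, rot_rot_inv]

lemma ae_mem_U (R : SO3) : ∀ᵐ x ∂dS, x ∈ U R := by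
  rw [ae_iff]
  refine measure_mono_null (U_compl_subset R) ?_
  rw [Set.insert_eq]
  exact measure_union_null (dS_singleton _) (dS_singleton _)

lemma restrict_U (R : SO3) : dS.restrict (U R) = dS :=
  Measure.restrict_eq_self_of_ae_mem (ae_mem_U R)

/-! ### Smoothness -/

/-- The formula for `ρ_R`, extended off the sphere. -/
def rhoExt (R : SO3) (w : E3) (i : Fin 3) : ℝ :=
  R.1 i 0 * (-rotVec R⁻¹ w 1 / Real.sqrt (rotVec R⁻¹ w 0 ^ 2 + rotVec R⁻¹ w 1 ^ 2)) +
    R.1 i 1 * (rotVec R⁻¹ w 0 / Real.sqrt (rotVec R⁻¹ w 0 ^ 2 + rotVec R⁻¹ w 1 ^ 2))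

/-- The complement of the axis through the poles of `U_R`. -/
def offAxis (R : SO3) : Set E3 := {w | rotVec R⁻¹ w 0 ^ 2 + rotVec R⁻¹ w 1 ^ 2 ≠ 0}

lemma mem_offAxis {R : SO3} {x : S2} (hx : x ∈ U R) : x.1 ∈ offAxis R := by
  have h := sin_colat_pos_of_mem_U hx
  have hy := sum_sq_eq_one (rot R⁻¹ x)
  rw [colatR, colat, Real.sin_arccos, Real.sqrt_pos] at h
  rw [rot_coe] at h hy
  rw [offAxis, Set.mem_ofPred_eq]
  intro h0
  rw [h0] at hy
  linarith

lemma rho_eq_rhoExt {R : SO3} {x : S2} (hx : x ∈ U R) (i : Fin 3) :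
    rho R x i = rhoExt R x.1 i := by
  have h := mem_offAxis hx
  have hc := cos_lon_mul (rot R⁻¹ x)
  have hs := sin_lon_mul (rot R⁻¹ x)
  rw [rot_coe] at hc hs
  have h0 : Real.sqrt (rotVec R⁻¹ x.1 0 ^ 2 + rotVec R⁻¹ x.1 1 ^ 2) ≠ 0 := by
    rw [Real.sqrt_ne_zero (by positivity)]; exact h
  rw [rho, rotVec_apply, rhoExt, rhoI]
  simp only [PiLp.toLp_apply, Matrix.cons_val]
  rw [mul_comm, ← eq_div_iff h0] at hc hs
  rw [hc, hs]
  ring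

lemma contDiff_coord (i : Fin 3) : ContDiff ℝ ∞ fun w : E3 => w i :=
  (EuclideanSpace.proj (𝕜 := ℝ) i).contDiff

lemma contDiff_rotVec_coord (R : SO3) (i : Fin 3) : ContDiff ℝ ∞ fun w : E3 => rotVec R w i :=
  (contDiff_coord i).comp (rotIso R).contDiff

lemma contDiffOn_rhoExt (R : SO3) (i : Fin 3) :
    ContDiffOn ℝ ∞ (fun w => rhoExt R w i) (offAxis R) := by
  have h0 := (contDiff_rotVec_coord R⁻¹ 0).contDiffOn (s := offAxis R)
  have h1 := (contDiff_rotVec_coord R⁻¹ 1).contDiffOn (s := offAxis R)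
  have hr : ContDiffOn ℝ ∞ (fun w => Real.sqrt (rotVec R⁻¹ w 0 ^ 2 + rotVec R⁻¹ w 1 ^ 2))
      (offAxis R) := ((h0.pow 2).add (h1.pow 2)).sqrt (fun w hw => hw)
  have hr0 : ∀ w ∈ offAxis R, Real.sqrt (rotVec R⁻¹ w 0 ^ 2 + rotVec R⁻¹ w 1 ^ 2) ≠ 0 :=
    fun w hw => by rw [Real.sqrt_ne_zero (by positivity)]; exact hw
  exact (contDiffOn_const.mul (h1.neg.div hr hr0)).add (contDiffOn_const.mul (h0.div hr hr0))

/-- `f` is the restriction to `U_R` of a function smooth near it in `ℝ³`. -/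
def SmoothOnU (R : SO3) (f : S2 → ℂ) : Prop :=
  ∃ g : E3 → ℂ, ContDiffOn ℝ ∞ g (offAxis R) ∧ ∀ x ∈ U R, f x = g x.1

lemma SmoothOnU.add {R : SO3} {f g : S2 → ℂ} (hf : SmoothOnU R f) (hg : SmoothOnU R g) :
    SmoothOnU R fun x => f x + g x := by
  obtain ⟨F, hF, hf⟩ := hf
  obtain ⟨G, hG, hg⟩ := hg
  exact ⟨_, hF.add hG, fun x hx => by simp only [hf x hx, hg x hx]⟩

lemma SmoothOnU.mul {R : SO3} {f g : S2 → ℂ} (hf : SmoothOnU R f) (hg : SmoothOnU R g) :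
    SmoothOnU R fun x => f x * g x := by
  obtain ⟨F, hF, hf⟩ := hf
  obtain ⟨G, hG, hg⟩ := hg
  exact ⟨_, hF.mul hG, fun x hx => by simp only [hf x hx, hg x hx]⟩

lemma SmoothOnU.star {R : SO3} {f : S2 → ℂ} (hf : SmoothOnU R f) :
    SmoothOnU R fun x => star (f x) := by
  obtain ⟨F, hF, hf⟩ := hf
  exact ⟨_, Complex.conjCLE.contDiff.comp_contDiffOn hF, fun x hx => by simp only [hf x hx]; rfl⟩

lemma SmoothOnU.pow {R : SO3} {f : S2 → ℂ} (hf : SmoothOnU R f) (n : ℕ) :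
    SmoothOnU R fun x => f x ^ n := by
  obtain ⟨F, hF, hf⟩ := hf
  exact ⟨_, hF.pow n, fun x hx => by simp only [hf x hx]⟩

lemma smoothOnU_const (R : SO3) (c : ℂ) : SmoothOnU R fun _ => c :=
  ⟨_, contDiffOn_const, fun _ _ => rfl⟩

lemma SmoothOnU.sum {R : SO3} {ι : Type*} (S : Finset ι) {f : ι → S2 → ℂ}
    (hf : ∀ i ∈ S, SmoothOnU R (f i)) : SmoothOnU R fun x => ∑ i ∈ S, f i x := by
  classical
  induction S using Finset.induction_on with
  | empty => simpa using smoothOnU_const R 0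
  | insert i S hi ih =>
    simp only [Finset.sum_insert hi]
    exact (hf i (Finset.mem_insert_self _ _)).add
      (ih fun j hj => hf j (Finset.mem_insert_of_mem hj))

lemma smoothOnU_coord (R : SO3) (i : Fin 3) : SmoothOnU R fun x => (x.1 i : ℂ) :=
  ⟨_, Complex.ofRealCLM.contDiff.comp_contDiffOn (contDiff_coord i).contDiffOn, fun _ _ => rfl⟩

lemma smoothOnU_rho (R : SO3) (i : Fin 3) : SmoothOnU R fun x => (rho R x i : ℂ) :=
  ⟨_, Complex.ofRealCLM.contDiff.comp_contDiffOn (contDiffOn_rhoExt R i),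
    fun x hx => by simp only [rho_eq_rhoExt hx]; rfl⟩

lemma smoothOnU_frame (R : SO3) (i : Fin 3) : SmoothOnU R fun x => frame R x i := by
  have hc := smoothOnU_coord R
  have hr := smoothOnU_rho R
  have hI := smoothOnU_const R Complex.I
  have hn := smoothOnU_const R (-1)
  -- The three components of the cross product with x, up to a cyclic shift of the indices.
  have key : ∀ i j k : Fin 3, SmoothOnU R fun x =>
      ((rho R x j : ℂ) * x.1 k + (-1) * ((rho R x k : ℂ) * x.1 j)) + Complex.I * rho R x i :=
    fun i j k => (((hr j).mul (hc k)).add (hn.mul ((hr k).mul (hc j)))).add (hI.mul (hr i))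
  fin_cases i
  · convert key 0 1 2 using 2 with x
    simp [frame, tvec_apply, J_zero]; ring
  · convert key 1 2 0 using 2 with x
    simp [frame, tvec_apply, J_one]; ring
  · convert key 2 0 1 using 2 with x
    simp [frame, tvec_apply, J_two]; ring

lemma smoothOnU_frameS (s : ℤ) (R : SO3) (i : Fin 3) : SmoothOnU R fun x => frameS s R x i := by
  unfold frameS
  split_ifs
  · exact smoothOnU_frame R i
  · exact (smoothOnU_frame R i).star

lemma SmoothOnU.dotProduct {R : SO3} {v : S2 → Fin 3 → ℂ}
    (hv : ∀ i, SmoothOnU R fun x => v x i) (a : Fin 3 → ℂ) : SmoothOnU R fun x => v x ⬝ᵥ a :=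
  SmoothOnU.sum _ fun i _ => (hv i).mul (smoothOnU_const R (a i))

lemma smoothOnU_spinPoly_coeff {l : ℕ} {s : ℤ} (hs : s.natAbs ≤ l) (R : SO3) (k : ℕ) :
    SmoothOnU R fun x => (spinPoly l s R x).coeff k := by
  obtain ⟨c, hc⟩ := exists_coeff_eq_sum_eval (2 * l + 1) k
  have : (fun x => (spinPoly l s R x).coeff k) = fun x => ∑ i ∈ Finset.range (2 * l + 1),
      c i * ((cvec x.1 ⬝ᵥ isoVec i) ^ (l - s.natAbs) *
        (frameS s R x ⬝ᵥ isoVec i) ^ s.natAbs) := by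
    funext x
    have hd : (spinPoly l s R x).natDegree < 2 * l + 1 := by
      have := natDegree_quad_pow_mul_le (cvec x.1) (frameS s R x) (l - s.natAbs) s.natAbs
      rw [spinPoly]; omega
    rw [hc _ hd]
    simp only [spinPoly, Polynomial.eval_mul, Polynomial.eval_pow, eval_quad]
  rw [this]
  exact SmoothOnU.sum _ fun i _ => (smoothOnU_const R _).mul
    (((SmoothOnU.dotProduct (smoothOnU_coord R) _).pow _).mul
      ((SmoothOnU.dotProduct (smoothOnU_frameS s R) _).pow _))

lemma contMDiff_coe_S2 : ContMDiff (𝓡 2) 𝓘(ℝ, E3) ∞ (Subtype.val : S2 → E3) := by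
  have : Fact (Module.finrank ℝ E3 = 2 + 1) := ⟨finrank_euclideanSpace_fin⟩
  exact contMDiff_coe_sphere

lemma SmoothOnU.contMDiffOn {R : SO3} {f : S2 → ℂ} (hf : SmoothOnU R f) :
    ContMDiffOn (𝓡 2) 𝓘(ℝ, ℂ) ∞ f (U R) := by
  obtain ⟨F, hF, hf⟩ := hf
  exact (hF.contMDiffOn.comp contMDiff_coe_S2.contMDiffOn
    (fun x hx => mem_offAxis hx)).congr hf

lemma isOpen_U (R : SO3) : IsOpen (U R) := by
  have : U R = (rotHomeo R) '' {northPole, southPole}ᶜ := rfl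
  rw [this, Homeomorph.isOpen_image]
  exact (Set.toFinite _).isClosed.isOpen_compl

lemma SmoothOnU.aestronglyMeasurable {R : SO3} {f : S2 → ℂ} (hf : SmoothOnU R f) :
    AEStronglyMeasurable f dS := by
  rw [← restrict_U R]
  exact hf.contMDiffOn.continuousOn.aestronglyMeasurable (isOpen_U R).measurableSet

lemma memLp_spinPoly_coeff {l : ℕ} {s : ℤ} (hs : s.natAbs ≤ l) (R : SO3) {k : ℕ}
    (hk : k ≤ 2 * l) : MemLp (fun x => (spinPoly l s R x).coeff k) 2 dS := by
  refine MemLp.of_bound (smoothOnU_spinPoly_coeff hs R k).aestronglyMeasurable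
    (Real.sqrt ((2 * l).choose k)) (ae_of_all _ fun x => ?_)
  exact Real.le_sqrt_of_sq_le (norm_spinPoly_coeff_sq_le hs hk R x)

end

section

open MeasureTheory Polynomial

/-! ### Orthonormality -/

lemma star_rotC (R : SO3) (w : Fin 3 → ℂ) : star (rotC R w) = rotC R (star w) := by
  ext i; simp [rotC, Complex.conj_ofReal]

/-- A rotation carries the frame of index 1 to the frame of index `R`; `frame_eq` returns to index 1
at the price of a phase. -/
lemma frameS_rot (s : ℤ) (R : SO3) (x : S2) :
    ∃ κ : ℂ, κ * star κ = 1 ∧ frameS s 1 (rot R x) = κ • rotC R (frameS s 1 x) := by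
  have h := frame_eq (R * 1) 1 (rot R x)
  rw [frame_rot] at h
  have hκ := exp_I_mul_star (psi (rot R x) 1 (R * 1))
  unfold frameS
  split_ifs
  · exact ⟨_, hκ, h⟩
  · refine ⟨_, ?_, by rw [h, star_smul, star_rotC]⟩
    rw [star_star, mul_comm, hκ]

lemma spinPoly_rot (l : ℕ) (s : ℤ) (R : SO3) (x : S2) :
    ∃ κ : ℂ, κ * star κ = 1 ∧ spinPoly l s 1 (rot R x) =
      C κ * (quad (rotC R (cvec x.1)) ^ (l - s.natAbs) *
        quad (rotC R (frameS s 1 x)) ^ s.natAbs) := by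
  obtain ⟨κ, hκ, h⟩ := frameS_rot s R x
  refine ⟨κ ^ s.natAbs, by rw [star_pow, ← mul_pow, hκ, one_pow], ?_⟩
  rw [spinPoly, h, quad_smul, rot_coe, cvec_rotVec, mul_pow, C_pow]
  ring

/-- The rotation by `τ` about the vertical axis. -/
def rotZ (τ : ℝ) : SO3 :=
  ⟨!![Real.cos τ, -Real.sin τ, 0; Real.sin τ, Real.cos τ, 0; 0, 0, 1], by
    have h := Real.sin_sq_add_cos_sq τ
    rw [Matrix.mem_specialOrthogonalGroup_iff, Matrix.mem_orthogonalGroup_iff]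
    constructor
    · ext i j
      fin_cases i <;> fin_cases j <;>
        simp [Matrix.mul_apply, Fin.sum_univ_three, Matrix.star_eq_conjTranspose] <;> nlinarith
    · simp [Matrix.det_fin_three]; nlinarith⟩

/-- The rotation about the `y`-axis with cosine `(1 - T²)/(1 + T²)` and sine `2T/(1 + T²)`. -/
def rotY (T : ℝ) : SO3 :=
  ⟨!![(1 - T ^ 2) / (1 + T ^ 2), 0, -(2 * T / (1 + T ^ 2)); 0, 1, 0;
      2 * T / (1 + T ^ 2), 0, (1 - T ^ 2) / (1 + T ^ 2)], by
    have h : (1 + T ^ 2) ≠ 0 := by positivity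
    rw [Matrix.mem_specialOrthogonalGroup_iff, Matrix.mem_orthogonalGroup_iff]
    constructor
    · ext i j
      fin_cases i <;> fin_cases j <;>
        simp [Matrix.mul_apply, Fin.sum_univ_three, Matrix.star_eq_conjTranspose] <;>
        field_simp <;> ring
    · simp [Matrix.det_fin_three]; field_simp; ring⟩

/-- Rotation about the vertical axis acts on the parameter of isotropic vectors by z ↦ e^{-iτ}z, so
each coefficient is an eigenvector with its own character. -/
lemma quad_rotZ (τ : ℝ) (w : Fin 3 → ℂ) :
    quad (rotC (rotZ τ) w) =
      C (Complex.exp (Complex.I * τ)) *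
        (quad w).comp (C (Complex.exp (-(Complex.I * τ))) * X) := by
  apply Polynomial.funext
  intro z
  have h1 : Complex.exp (Complex.I * τ) = Complex.cos τ + Complex.I * Complex.sin τ := by
    rw [mul_comm, Complex.exp_mul_I]; ring
  have h2 : Complex.exp (-(Complex.I * τ)) = Complex.cos τ - Complex.I * Complex.sin τ := by
    rw [← mul_neg, mul_comm, Complex.exp_mul_I, Complex.cos_neg, Complex.sin_neg]; ring
  have h3 : Complex.exp (Complex.I * τ) * Complex.exp (-(Complex.I * τ)) = 1 := by
    rw [← Complex.exp_add]; simp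
  rw [eval_mul, eval_C, eval_comp, eval_mul, eval_C, eval_X, eval_quad, eval_quad]
  simp only [rotC, rotZ, isoVec, dotProduct, Fin.sum_univ_three, Matrix.of_apply, Matrix.cons_val]
  push_cast
  set e := Complex.exp (Complex.I * τ)
  set e' := Complex.exp (-(Complex.I * τ))
  have e3 : e' ^ 2 * e = e' := by linear_combination e' * h3
  linear_combination -(w 0 / 2 + Complex.I * w 1 / 2) * h1 -
    ((-w 0 + Complex.I * w 1) / 2 * z ^ 2) * (h2 + e3) - z * w 2 * h3 +
    w 1 * Complex.sin τ / 2 * (z ^ 2 - 1) * Complex.I_sq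

/-- `T` is the tangent of half the angle: the inverse rotation takes `isoVec T` to (1 + T²) times
`isoVec 0`. -/
lemma eval_quad_rotY (T : ℝ) (w : Fin 3 → ℂ) :
    (quad (rotC (rotY T) w)).eval (T : ℂ) = (1 + T ^ 2) * (quad w).eval 0 := by
  have h : (1 + (T : ℂ) ^ 2) ≠ 0 := by
    have : (1 + T ^ 2 : ℝ) ≠ 0 := by positivity
    exact_mod_cast this
  rw [eval_quad, eval_quad]
  simp only [rotC, rotY, isoVec, dotProduct, Fin.sum_univ_three, Matrix.of_apply, Matrix.cons_val]
  push_cast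
  field_simp
  ring

/-- Gram matrix of the coefficients of `spinPoly`. -/
def gram (l : ℕ) (s : ℤ) (j k : ℕ) : ℂ :=
  ∫ x, (spinPoly l s 1 x).coeff j * star ((spinPoly l s 1 x).coeff k) ∂dS

lemma gram_eq_zero {l : ℕ} {s : ℤ} (hs : s.natAbs ≤ l) {j k : ℕ} (hjk : j ≠ k) :
    gram l s j k = 0 := by
  have hne : ((j : ℝ) - k) ≠ 0 := sub_ne_zero.2 (by exact_mod_cast hjk)
  -- This angle makes the relative phase of the j-th and k-th coefficients equal to -1, so rotation
  -- invariance forces the entry to equal its negative.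
  set τ : ℝ := Real.pi / ((j : ℝ) - k) with hτ
  have hτ' : ((j : ℂ) - k) * τ = Real.pi := by
    rw [hτ]; push_cast
    have : ((j : ℂ) - k) ≠ 0 := by exact_mod_cast hne
    field_simp
  have h : gram l s j k = -gram l s j k := by
    conv_lhs => rw [gram, ← integral_rot (rotZ τ)]
    rw [gram, ← integral_neg]
    refine integral_congr_ae (ae_of_all _ fun x => ?_)
    obtain ⟨κ, hκ, hx⟩ := spinPoly_rot l s (rotZ τ) x
    have hx' : spinPoly l s 1 (rot (rotZ τ) x) = C (κ * Complex.exp (Complex.I * τ) ^ l) *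
        (spinPoly l s 1 x).comp (C (Complex.exp (-(Complex.I * τ))) * X) := by
      have hl : ∀ a : ℂ, a ^ l = a ^ (l - s.natAbs) * a ^ s.natAbs := fun a => by
        rw [← pow_add, Nat.sub_add_cancel hs]
      rw [hx, quad_rotZ, quad_rotZ, spinPoly, mul_comp, pow_comp, pow_comp, mul_pow, mul_pow, hl]
      simp only [C_mul, C_pow]
      ring
    have he := exp_I_mul_star τ
    have he2 := star_exp_I_mul τ
    have he3 : star (Complex.exp (-(Complex.I * τ))) = Complex.exp (Complex.I * τ) := by
      rw [← he2, star_star]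
    have hm : Complex.exp (-(Complex.I * τ)) ^ j * Complex.exp (Complex.I * τ) ^ k = -1 := by
      rw [← Complex.exp_nat_mul, ← Complex.exp_nat_mul, ← Complex.exp_add]
      have : (j : ℂ) * -(Complex.I * τ) + k * (Complex.I * τ) = -(Real.pi * Complex.I) := by
        rw [← hτ']; ring
      rw [this, Complex.exp_neg, Complex.exp_pi_mul_I]; norm_num
    simp only [hx', coeff_C_mul, comp_C_mul_X_coeff, star_mul', star_pow, he3]
    set a := (spinPoly l s 1 x).coeff j
    set b := (spinPoly l s 1 x).coeff k
    have hel : Complex.exp (Complex.I * τ) ^ l * star (Complex.exp (Complex.I * τ)) ^ l = 1 := by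
      rw [← mul_pow, he, one_pow]
    calc _ = (κ * star κ) * (Complex.exp (Complex.I * τ) ^ l *
          star (Complex.exp (Complex.I * τ)) ^ l) *
          (Complex.exp (-(Complex.I * τ)) ^ j * Complex.exp (Complex.I * τ) ^ k) *
          (a * star b) := by ring
      _ = -(a * star b) := by rw [hκ, hel, hm]; ring
  linear_combination h / 2

lemma MemLp.integrable_mul_star {f g : S2 → ℂ} (hf : MemLp f 2 dS) (hg : MemLp g 2 dS) :
    Integrable (fun x => f x * star (g x)) dS :=
  hf.integrable_mul hg.star

/-- By rotation invariance the integral of |P(T)|², P being `spinPoly`, is (1 + T²)^{2l} times that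
of |P(0)|². By orthogonality it is also Σ T^{2k} `gram l s k k`, and powers of T² are compared. -/
lemma gram_diag {l : ℕ} {s : ℤ} (hs : s.natAbs ≤ l) {k : ℕ} (hk : k ≤ 2 * l) :
    gram l s k k = ((2 * l).choose k : ℂ) * gram l s 0 0 := by
  refine coeff_eq_of_sum_pow_eq (n := 2 * l) (a := fun k => gram l s k k)
    (b := fun k => ((2 * l).choose k : ℂ) * gram l s 0 0) (fun t ht => ?_) hk
  obtain ⟨T, rfl⟩ : ∃ T : ℝ, t = T ^ 2 := ⟨Real.sqrt t, (Real.sq_sqrt ht).symm⟩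
  have h1 : ∫ x, (spinPoly l s 1 x).eval (T : ℂ) * star ((spinPoly l s 1 x).eval (T : ℂ)) ∂dS =
      ((T : ℂ) ^ 2 + 1) ^ (2 * l) * gram l s 0 0 := by
    rw [← integral_rot (rotY T), gram, ← integral_const_mul]
    refine integral_congr_ae (ae_of_all _ fun x => ?_)
    obtain ⟨κ, hκ, hx⟩ := spinPoly_rot l s (rotY T) x
    have hx' : (spinPoly l s 1 (rot (rotY T) x)).eval (T : ℂ) =
        κ * (1 + (T : ℂ) ^ 2) ^ l * (spinPoly l s 1 x).coeff 0 := by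
      have hl : (1 + (T : ℂ) ^ 2) ^ l =
          (1 + (T : ℂ) ^ 2) ^ (l - s.natAbs) * (1 + (T : ℂ) ^ 2) ^ s.natAbs := by
        rw [← pow_add, Nat.sub_add_cancel hs]
      rw [coeff_zero_eq_eval_zero, hx, spinPoly]
      simp only [eval_mul, eval_pow, eval_C, eval_quad_rotY, mul_pow]
      rw [hl]
      ring
    have hT : star (1 + (T : ℂ) ^ 2) = 1 + (T : ℂ) ^ 2 := by
      have := Complex.conj_ofReal (1 + T ^ 2)
      push_cast at this
      exact this
    simp only [hx', star_mul', star_pow, hT]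
    set a := (spinPoly l s 1 x).coeff 0
    linear_combination ((1 + (T : ℂ) ^ 2) ^ (2 * l) * a * star a) * hκ
  have h2 : ∫ x, (spinPoly l s 1 x).eval (T : ℂ) * star ((spinPoly l s 1 x).eval (T : ℂ)) ∂dS =
      ∑ j ∈ Finset.range (2 * l + 1), ∑ k ∈ Finset.range (2 * l + 1),
        (T : ℂ) ^ j * (T : ℂ) ^ k * gram l s j k := by
    have hev : ∀ x, (spinPoly l s 1 x).eval (T : ℂ) * star ((spinPoly l s 1 x).eval (T : ℂ)) =
        ∑ j ∈ Finset.range (2 * l + 1), ∑ k ∈ Finset.range (2 * l + 1),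
        (T : ℂ) ^ j * (T : ℂ) ^ k *
          ((spinPoly l s 1 x).coeff j * star ((spinPoly l s 1 x).coeff k)) := by
      intro x
      have hd : (spinPoly l s 1 x).natDegree < 2 * l + 1 := by
        have := natDegree_quad_pow_mul_le (cvec x.1) (frameS s 1 x) (l - s.natAbs) s.natAbs
        rw [spinPoly]; omega
      have hT : star (T : ℂ) = T := Complex.conj_ofReal _
      rw [eval_eq_sum_range' hd, star_sum, Finset.sum_mul_sum]
      refine Finset.sum_congr rfl fun j _ => Finset.sum_congr rfl fun k _ => ?_
      rw [star_mul', star_pow, hT]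
      ring
    simp only [hev]
    have hint : ∀ j ∈ Finset.range (2 * l + 1), ∀ k ∈ Finset.range (2 * l + 1),
        Integrable (fun x => (T : ℂ) ^ j * (T : ℂ) ^ k *
          ((spinPoly l s 1 x).coeff j * star ((spinPoly l s 1 x).coeff k))) dS := by
      intro j hj k hk
      rw [Finset.mem_range, Nat.lt_succ_iff] at hj hk
      exact (MemLp.integrable_mul_star (memLp_spinPoly_coeff hs 1 hj)
        (memLp_spinPoly_coeff hs 1 hk)).const_mul _
    rw [integral_finsetSum _ fun j hj => integrable_finsetSum _ fun k hk => hint j hj k hk]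
    refine Finset.sum_congr rfl fun j hj => ?_
    rw [integral_finsetSum _ fun k hk => hint j hj k hk]
    refine Finset.sum_congr rfl fun k hk => ?_
    rw [integral_const_mul, gram]
  rw [h1] at h2
  have h3 : ∑ k ∈ Finset.range (2 * l + 1), ((2 * l).choose k : ℂ) * gram l s 0 0 *
      ((T ^ 2 : ℝ) : ℂ) ^ k = ((T : ℂ) ^ 2 + 1) ^ (2 * l) * gram l s 0 0 := by
    rw [add_pow, Finset.sum_mul]
    refine Finset.sum_congr rfl fun k _ => ?_
    push_cast
    ring
  rw [h3, h2]
  refine Finset.sum_congr rfl fun j hj => ?_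
  rw [Finset.sum_eq_single_of_mem j hj fun k _ hkj => by
    rw [gram_eq_zero hs (Ne.symm hkj), mul_zero]]
  push_cast
  ring

lemma memLp_harm {l : ℕ} {s : ℤ} (hs : s.natAbs ≤ l) (R : SO3) {m : ℤ}
    (hm : m ∈ Set.Icc (-(l : ℤ)) l) : MemLp (harm s l m R) 2 dS :=
  (memLp_spinPoly_coeff hs R (k := (l - m).toNat) (by
    obtain ⟨h1, h2⟩ := hm; omega)).const_mul _

lemma integral_harm_mul_star (l : ℕ) (s m m' : ℤ) :
    ∫ x, harm s l m 1 x * star (harm s l m' 1 x) ∂dS =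
      spinConst s l m * spinConst s l m' * gram l s (l - m).toNat (l - m').toNat := by
  rw [gram, ← integral_const_mul]
  refine integral_congr_ae (ae_of_all _ fun x => ?_)
  have hr : star (spinConst s l m' : ℂ) = spinConst s l m' := Complex.conj_ofReal _
  simp only [harm, star_mul', hr]
  ring

lemma harm_orthogonal {l : ℕ} {s : ℤ} (hs : s.natAbs ≤ l) {m m' : ℤ}
    (hm : m ∈ Set.Icc (-(l : ℤ)) l) (hm' : m' ∈ Set.Icc (-(l : ℤ)) l) (hmm : m ≠ m') :
    ∫ x, harm s l m 1 x * star (harm s l m' 1 x) ∂dS = 0 := by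
  obtain ⟨h1, h2⟩ := hm
  obtain ⟨h3, h4⟩ := hm'
  rw [integral_harm_mul_star, gram_eq_zero hs (by omega), mul_zero]

/-- All 2l + 1 norms share one value c, by `gram_diag` and `spinConst_sq`. Their sum is the integral
of the constant (2l+1)/4π over the sphere, so c = 1 with no explicit integration. -/
lemma harm_normalized {l : ℕ} {s : ℤ} (hs : s.natAbs ≤ l) {m : ℤ}
    (hm : m ∈ Set.Icc (-(l : ℤ)) l) :
    ∫ x, harm s l m 1 x * star (harm s l m 1 x) ∂dS = 1 := by
  set c : ℂ := ((2 * l).choose (l - s).toNat : ℂ) * ((2 * l + 1) / (4 * Real.pi)) * gram l s 0 0 with hcdef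
  have h : ∀ m ∈ Set.Icc (-(l : ℤ)) l, ∫ x, harm s l m 1 x * star (harm s l m 1 x) ∂dS = c := by
    intro m hm
    have hk : (l - m).toNat ≤ 2 * l := by obtain ⟨h1, h2⟩ := hm; omega
    have h1 := congrArg (fun r : ℝ => (r : ℂ)) (spinConst_sq hs hm)
    push_cast at h1
    have hc : ((2 * l).choose (l - m).toNat : ℂ) ≠ 0 := by
      exact_mod_cast (Nat.choose_pos hk).ne'
    rw [integral_harm_mul_star, gram_diag hs hk, ← sq, h1, hcdef]
    field_simp
  have hsum : ∑ m ∈ Finset.Icc (-(l : ℤ)) l, ∫ x, harm s l m 1 x * star (harm s l m 1 x) ∂dS =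
      2 * l + 1 := by
    rw [← integral_finsetSum _ fun m hm => MemLp.integrable_mul_star
      (memLp_harm hs 1 (by simpa using hm)) (memLp_harm hs 1 (by simpa using hm))]
    simp only [sum_harm_mul_star hs]
    rw [integral_const, dS_real_univ, Complex.real_smul]
    push_cast
    have : (Real.pi : ℂ) ≠ 0 := by exact_mod_cast Real.pi_ne_zero
    field_simp
  rw [Finset.sum_congr rfl fun m hm => h m (by simpa using hm), Finset.sum_const, Int.card_Icc,
    nsmul_eq_mul, show ((l : ℤ) + 1 - -(l : ℤ)).toNat = 2 * l + 1 by omega] at hsum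
  push_cast at hsum
  have h0 : (2 * (l : ℂ) + 1) ≠ 0 := by exact_mod_cast (Nat.succ_ne_zero (2 * l))
  rw [h m hm]
  exact mul_left_cancel₀ h0 (by rw [hsum, mul_one])

end

section

open MeasureTheory Polynomial

/-! ### The projection kernel -/

/-- The polynomial has degree |s| in the frame, conjugated for negative s, so the phases of
`frame_eq` multiply to e^{isψ}. -/
lemma spinPoly_eq_C_mul (l : ℕ) (s : ℤ) (R₁ R₂ : SO3) (x : S2) :
    spinPoly l s R₂ x =
      C (Complex.exp (Complex.I * s * psi x R₂ R₁)) * spinPoly l s R₁ x := by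
  have h := frame_eq R₁ R₂ x
  unfold spinPoly frameS
  split_ifs with h0
  · have : Complex.exp (Complex.I * s * psi x R₂ R₁) =
        Complex.exp (Complex.I * psi x R₂ R₁) ^ s.natAbs := by
      rw [← Complex.exp_nat_mul]
      congr 1
      have hs : (s : ℂ) = (s.natAbs : ℂ) := by
        rw [← Int.cast_natCast, Int.natAbs_of_nonneg h0]
      rw [hs]; ring
    rw [h, quad_smul, this, mul_pow, C_pow]
    ring
  · have : Complex.exp (Complex.I * s * psi x R₂ R₁) =
        star (Complex.exp (Complex.I * psi x R₂ R₁)) ^ s.natAbs := by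
      rw [star_exp_I_mul, ← Complex.exp_nat_mul]
      congr 1
      have hs : (s : ℂ) = -(s.natAbs : ℂ) := by
        have : s = -(s.natAbs : ℤ) := by omega
        exact_mod_cast congrArg (fun z : ℤ => (z : ℂ)) this
      rw [hs]; ring
    rw [h, star_smul, quad_smul, this, mul_pow, C_pow]
    ring

lemma spinY_eq_harm {s : ℤ} {l : ℕ} (hs : s.natAbs ≤ l) {m : ℤ} (hm : m ∈ Set.Icc (-(l : ℤ)) l)
    {R : SO3} {x : S2} (hx : x ∈ U R) : spinY s l m R x = harm s l m R x :=
  spinY_eq hs hm hx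

lemma hasSpin_spinY {s : ℤ} {l : ℕ} (hs : s.natAbs ≤ l) {m : ℤ}
    (hm : m ∈ Set.Icc (-(l : ℤ)) l) : HasSpin s (spinY s l m) := by
  intro R₁ R₂ x h₁ h₂
  rw [spinY_eq hs hm h₁, spinY_eq hs hm h₂, spinPoly_eq_C_mul l s R₁ R₂, coeff_C_mul]
  ring

lemma spinY_ae_eq {s : ℤ} {l : ℕ} (hs : s.natAbs ≤ l) {m : ℤ}
    (hm : m ∈ Set.Icc (-(l : ℤ)) l) (R : SO3) : spinY s l m R =ᵐ[dS] harm s l m R := by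
  filter_upwards [ae_mem_U R] with x hx
  exact spinY_eq_harm hs hm hx

/-! ### Square integrable spin functions and their inner product -/

lemma IsL2Spin.memLp {s : ℤ} {f : Family} (hf : IsL2Spin s f) (R : SO3) : MemLp (f R) 2 dS := by
  have := hf.2 R
  rwa [restrict_U] at this

lemma isL2Spin_spinY {s : ℤ} {l : ℕ} (hs : s.natAbs ≤ l) {m : ℤ}
    (hm : m ∈ Set.Icc (-(l : ℤ)) l) : IsL2Spin s (spinY s l m) := by
  refine ⟨hasSpin_spinY hs hm, fun R => ?_⟩
  rw [restrict_U]
  exact (memLp_harm hs R hm).ae_eq (spinY_ae_eq hs hm R).symm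

lemma isL2Spin_zero (s : ℤ) : IsL2Spin s 0 :=
  ⟨fun _ _ _ _ _ => by simp, fun _ => MemLp.zero⟩

lemma IsL2Spin.add {s : ℤ} {f g : Family} (hf : IsL2Spin s f) (hg : IsL2Spin s g) :
    IsL2Spin s (f + g) :=
  ⟨fun R₁ R₂ x h₁ h₂ => by
    simp only [Pi.add_apply, hf.1 R₁ R₂ x h₁ h₂, hg.1 R₁ R₂ x h₁ h₂]; ring,
    fun R => (hf.2 R).add (hg.2 R)⟩

lemma IsL2Spin.smul {s : ℤ} {f : Family} (c : ℂ) (hf : IsL2Spin s f) : IsL2Spin s (c • f) :=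
  ⟨fun R₁ R₂ x h₁ h₂ => by
    simp only [Pi.smul_apply, smul_eq_mul, hf.1 R₁ R₂ x h₁ h₂]; ring,
    fun R => (hf.2 R).const_smul c⟩

lemma isL2Spin_of_mem_spinH {s : ℤ} {l : ℕ} (hs : s.natAbs ≤ l) {h : Family}
    (hh : h ∈ spinH l s) : IsL2Spin s h := by
  unfold spinH at hh
  induction hh using Submodule.span_induction with
  | mem x hx => obtain ⟨m, hm, rfl⟩ := hx; exact isL2Spin_spinY hs hm
  | zero => exact isL2Spin_zero s
  | add x y _ _ hx hy => exact hx.add hy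
  | smul c x _ hx => exact hx.smul c

lemma contMDiffOn_projKernel {s : ℤ} {l : ℕ} (hs : s.natAbs ≤ l) (R' R : SO3) :
    ContMDiffOn ((𝓡 2).prod (𝓡 2)) 𝓘(ℝ, ℂ) ∞
      (fun p : S2 × S2 => projKernel l s R' R p.1 p.2) (U R' ×ˢ U R) := by
  have h1 : ∀ (R : SO3) (m : ℤ), ContMDiffOn (𝓡 2) 𝓘(ℝ, ℂ) ∞ (harm s l m R) (U R) :=
    fun R m => ((smoothOnU_const R _).mul (smoothOnU_spinPoly_coeff hs R _)).contMDiffOn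
  have h2 : ∀ m : ℤ, ContMDiffOn (𝓡 2) 𝓘(ℝ, ℂ) ∞ (fun x => star (harm s l m R x)) (U R) :=
    fun m => ((smoothOnU_const R _).mul (smoothOnU_spinPoly_coeff hs R _)).star.contMDiffOn
  have h3 : ContMDiffOn ((𝓡 2).prod (𝓡 2)) 𝓘(ℝ, ℂ) ∞
      (fun p : S2 × S2 => ∑ m ∈ Finset.Icc (-(l : ℤ)) l,
        harm s l m R' p.1 * star (harm s l m R p.2)) (U R' ×ˢ U R) := by
    refine contMDiffOn_finsetSum fun m _ => ?_
    exact (contDiff_mul (𝕜 := ℝ) (𝔸 := ℂ)).contMDiff.comp_contMDiffOn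
      (((h1 R' m).comp contMDiffOn_fst fun p hp => hp.1).prodMk_space
        ((h2 m).comp contMDiffOn_snd fun p hp => hp.2))
  refine h3.congr fun p hp => ?_
  refine Finset.sum_congr rfl fun m hm => ?_
  rw [spinY_eq_harm hs (by simpa using hm) hp.1, spinY_eq_harm hs (by simpa using hm) hp.2]
  rfl

lemma spinInner_eq (f g : Family) : spinInner f g = ∫ x, f 1 x * star (g 1 x) ∂dS := by
  rw [spinInner, restrict_U]; rfl

lemma spinInner_spinY {s : ℤ} {l : ℕ} (hs : s.natAbs ≤ l) {m m' : ℤ}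
    (hm : m ∈ Set.Icc (-(l : ℤ)) l) (hm' : m' ∈ Set.Icc (-(l : ℤ)) l) :
    spinInner (spinY s l m) (spinY s l m') = if m = m' then 1 else 0 := by
  rw [spinInner_eq]
  have : ∫ x, spinY s l m 1 x * star (spinY s l m' 1 x) ∂dS =
      ∫ x, harm s l m 1 x * star (harm s l m' 1 x) ∂dS := by
    refine integral_congr_ae ?_
    filter_upwards [spinY_ae_eq hs hm 1, spinY_ae_eq hs hm' 1] with x h1 h2
    rw [h1, h2]
  rw [this]
  split_ifs with h
  · subst h; exact harm_normalized hs hm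
  · exact harm_orthogonal hs hm hm' h

lemma spinInner_add_left {s : ℤ} {f g h : Family} (hf : IsL2Spin s f) (hg : IsL2Spin s g)
    (hh : IsL2Spin s h) : spinInner (f + g) h = spinInner f h + spinInner g h := by
  simp only [spinInner_eq, Pi.add_apply, add_mul]
  exact integral_add (MemLp.integrable_mul_star (hf.memLp 1) (hh.memLp 1))
    (MemLp.integrable_mul_star (hg.memLp 1) (hh.memLp 1))

lemma spinInner_add_right {s : ℤ} {f g h : Family} (hf : IsL2Spin s f) (hg : IsL2Spin s g)
    (hh : IsL2Spin s h) : spinInner f (g + h) = spinInner f g + spinInner f h := by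
  simp only [spinInner_eq, Pi.add_apply, star_add, mul_add]
  exact integral_add (MemLp.integrable_mul_star (hf.memLp 1) (hg.memLp 1))
    (MemLp.integrable_mul_star (hf.memLp 1) (hh.memLp 1))

lemma spinInner_smul_left (c : ℂ) (f h : Family) : spinInner (c • f) h = c * spinInner f h := by
  simp only [spinInner_eq, Pi.smul_apply, smul_eq_mul, mul_assoc]
  exact integral_const_mul _ _

lemma spinInner_smul_right (c : ℂ) (f h : Family) :
    spinInner f (c • h) = star c * spinInner f h := by
  simp only [spinInner_eq, Pi.smul_apply, smul_eq_mul, star_mul', mul_left_comm _ (star c)]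
  exact integral_const_mul _ _

lemma spinInner_zero_right (f : Family) : spinInner f 0 = 0 := by simp [spinInner]

lemma spinInner_sum_left {s : ℤ} {ι : Type*} (S : Finset ι) {f : ι → Family} {h : Family}
    (hf : ∀ i ∈ S, IsL2Spin s (f i)) (hh : IsL2Spin s h) :
    spinInner (∑ i ∈ S, f i) h = ∑ i ∈ S, spinInner (f i) h ∧ IsL2Spin s (∑ i ∈ S, f i) := by
  classical
  induction S using Finset.induction_on with
  | empty => simpa [spinInner] using isL2Spin_zero s
  | insert i S hi ih =>
    obtain ⟨h1, h2⟩ := ih fun j hj => hf j (Finset.mem_insert_of_mem hj)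
    have h3 := hf i (Finset.mem_insert_self _ _)
    rw [Finset.sum_insert hi, Finset.sum_insert hi, spinInner_add_left h3 h2 hh, h1]
    exact ⟨rfl, h3.add h2⟩

/-- The pairing of spin functions may be computed in any of the trivialisations. -/
lemma integral_mul_star_eq_spinInner {s : ℤ} {f g : Family} (hf : HasSpin s f) (hg : HasSpin s g)
    (R : SO3) : ∫ x in U R, f R x * star (g R x) ∂dS = spinInner f g := by
  rw [spinInner_eq, restrict_U]
  refine integral_congr_ae ?_
  filter_upwards [ae_mem_U R, ae_mem_U 1] with x h1 h2
  rw [hf 1 R x h2 h1, hg 1 R x h2 h1, star_mul']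
  -- Both functions pick up the same unimodular factor, which cancels against its conjugate.
  have h3 := exp_I_mul_star (s * psi x R 1)
  push_cast at h3
  rw [← mul_assoc] at h3
  linear_combination (f 1 x * star (g 1 x)) * h3

lemma isProjectionKernel_projKernel {s : ℤ} {l : ℕ} (hs : s.natAbs ≤ l) :
    IsProjectionKernel s (spinH l s) (projKernel l s) := by
  refine ⟨fun h hh => isL2Spin_of_mem_spinH hs hh, contMDiffOn_projKernel hs, fun f hf => ?_⟩
  set I := Finset.Icc (-(l : ℤ)) l with hI
  have hmem : ∀ m ∈ I, m ∈ Set.Icc (-(l : ℤ)) l := fun m hm => by simpa [hI] using hm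
  have hY : ∀ m ∈ I, IsL2Spin s (spinY s l m) := fun m hm => isL2Spin_spinY hs (hmem m hm)
  -- The Fourier sum of `f`, with coefficients computed at R = I; by
  -- `integral_mul_star_eq_spinInner` the kernel integral in any `R` gives the same coefficients.
  set g : Family := ∑ m ∈ I, spinInner f (spinY s l m) • spinY s l m with hg
  have hgH : g ∈ spinH l s := Submodule.sum_mem _ fun m hm =>
    Submodule.smul_mem _ _ (Submodule.subset_span ⟨m, hmem m hm, rfl⟩)
  have hgL := isL2Spin_of_mem_spinH hs hgH
  have hfg : IsL2Spin s (f - g) := by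
    have := hf.add (hgL.smul (-1))
    rwa [neg_one_smul, ← sub_eq_add_neg] at this
  refine ⟨g, hgH, fun h hh => ?_, fun R' R x hx => ?_⟩
  · have hh' := hh
    unfold spinH at hh'
    induction hh' using Submodule.span_induction with
    | mem y hy =>
      obtain ⟨m', hm', rfl⟩ := hy
      have hmI : m' ∈ I := by simpa [hI] using hm'
      have hYm := hY m' hmI
      have h1 : spinInner g (spinY s l m') = spinInner f (spinY s l m') := by
        rw [hg, (spinInner_sum_left I (fun m hm => (hY m hm).smul _) hYm).1]
        rw [Finset.sum_eq_single_of_mem m' hmI fun m hm hne => by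
          rw [spinInner_smul_left, spinInner_spinY hs (hmem m hm) hm', if_neg hne, mul_zero]]
        rw [spinInner_smul_left, spinInner_spinY hs hm' hm', if_pos rfl, mul_one]
      -- Additivity for (f - g) + g = f, where g and f have the same pairing with the basis element.
      have h2 := spinInner_add_left hfg hgL hYm
      rw [sub_add_cancel, h1] at h2
      linear_combination -h2
    | zero => exact spinInner_zero_right _
    | add y z hy hz hy' hz' =>
      rw [spinInner_add_right hfg (isL2Spin_of_mem_spinH hs hy) (isL2Spin_of_mem_spinH hs hz),
        hy' hy, hz' hz, add_zero]
    | smul c y hy hy' => rw [spinInner_smul_right, hy' hy, mul_zero]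
  · have h1 : ∀ y, projKernel l s R' R x y * f R y =
        ∑ m ∈ I, spinY s l m R' x * (f R y * star (spinY s l m R y)) := by
      intro y
      rw [projKernel, Finset.sum_mul]
      refine Finset.sum_congr rfl fun m _ => ?_
      rw [starRingEnd_apply]; ring
    simp only [h1]
    rw [integral_finsetSum _ fun m hm => by
      rw [restrict_U]
      exact (MemLp.integrable_mul_star (hf.memLp R) ((hY m hm).memLp R)).const_mul _]
    rw [hg, Finset.sum_apply, Finset.sum_apply]
    refine Finset.sum_congr rfl fun m hm => ?_
    rw [integral_const_mul, integral_mul_star_eq_spinInner hf.1 (hY m hm).1, Pi.smul_apply,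
      Pi.smul_apply, smul_eq_mul, mul_comm]

lemma projKernel_diag {s : ℤ} {l : ℕ} (hs : s.natAbs ≤ l) {R : SO3} {x : S2} (hx : x ∈ U R) :
    projKernel l s R R x x = (2 * (l : ℂ) + 1) / (4 * (Real.pi : ℂ)) := by
  rw [← sum_harm_mul_star hs R x]
  refine Finset.sum_congr rfl fun m hm => ?_
  rw [spinY_eq_harm hs (by simpa using hm) hx]
  rfl

end

end SpinSphere

end


theorem theorem5p2 (l : ℕ) (s : ℤ) (hs : |s| ≤ (l : ℤ)) :
    SpinSphere.IsProjectionKernel s (SpinSphere.spinH l s) (SpinSphere.projKernel l s) ∧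
      ∀ (R : SpinSphere.SO3) (x : SpinSphere.S2), x ∈ SpinSphere.U R →
        SpinSphere.projKernel l s R R x x = (2 * (l : ℂ) + 1) / (4 * (Real.pi : ℂ)) := by
  have hs' : s.natAbs ≤ l := by
    rw [← Int.natCast_natAbs] at hs
    exact_mod_cast hs
  exact ⟨SpinSphere.isProjectionKernel_projKernel hs', fun R x hx =>
    SpinSphere.projKernel_diag hs' hx⟩
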